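/- For $c \in \mathbb{C}$ let $f_c(z) = z^2 + c$ and let $\lambda_c(z) = \lim_{n\to\infty} 2^{-n} \log^+ |f_c^n(z)|$ be its escape-rate function on $\mathbb{C}$, where $\log^+ = \max\{\log, 0\}$. Let $\mu_c = \frac{1}{2\pi} \Delta \lambda_c$ be the equilibrium measure of $f_c$, the Laplacian being taken in the sense of distributions. For $c_1, c_2 \in \mathbb{C}$ define the archimedean energy $E_\infty(c_1,c_2) = \int \lambda_{c_1} \, d\mu_{c_2}$. There exist constants $C, C' > 0$ such that for all $c_1, c_2 \in \mathbb{C}$ the function $\lambda_{c_1}$ is $\mu_{c_2}$-integrable and $$\frac{1}{16} \log^+ |c_1 - c_2| - C \;\leq\; E_\infty(c_1,c_2) \;\leq\; \frac12 \log^+ \max\{|c_1|, |c_2|\} + C'.$$ Furthermore, with $L = 1000$: for all $c_1, c_2 \in \mathbb{C}$, if $r := \max\{|c_1|, |c_2|\} \geq L$ and $|c_1 - c_2| \geq 3/r^{1/2}$, then $$E_\infty(c_1,c_2) \;\geq\; \frac{1}{64} \log r.$$ -/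

import Mathlib

open Filter Topology MeasureTheory
open scoped Real ContDiff

/-- The quadratic polynomial `f_c(z) = z² + c`. -/
def quadraticMap (c z : ℂ) : ℂ := z ^ 2 + c

/-- The escape rate `λ_c(z) = lim_{n → ∞} 2⁻ⁿ log⁺ |f_cⁿ(z)|`. The limit exists for every `c` and
`z`: see `tendsto_escapeRate`. -/
noncomputable def escapeRate (c z : ℂ) : ℝ :=
  limUnder atTop fun n : ℕ => 1 / 2 ^ n * Real.posLog ‖(quadraticMap c)^[n] z‖

namespace QuadraticEnergy

/-- A smooth approximation of `log⁺ |z|`. -/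
noncomputable def smoothLog (z : ℂ) : ℝ := 1 / 2 * Real.log (1 + Complex.normSq z)

/-- Smooth approximations of the escape rate. -/
noncomputable def approxRate (c : ℂ) (n : ℕ) (z : ℂ) : ℝ :=
  1 / 2 ^ n * smoothLog ((quadraticMap c)^[n] z)

noncomputable def growthConst (c : ℂ) : ℝ := 1 / 2 * Real.log (4 + 4 * ‖c‖ ^ 2)

lemma abs_smoothLog_quadraticMap_sub (c z : ℂ) :
    |smoothLog (quadraticMap c z) - 2 * smoothLog z| ≤ growthConst c := by
  have h1 : ‖quadraticMap c z‖ ≤ ‖z‖ ^ 2 + ‖c‖ := by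
    rw [← norm_pow]
    exact norm_add_le (z ^ 2) c
  have h2 : ‖z‖ ^ 2 ≤ ‖quadraticMap c z‖ + ‖c‖ := by
    have := norm_sub_le (z ^ 2 + c) c
    rwa [add_sub_cancel_right, norm_pow] at this
  have hw := norm_nonneg (quadraticMap c z)
  unfold smoothLog growthConst
  simp only [Complex.normSq_eq_norm_sq]
  generalize ‖quadraticMap c z‖ = w at *
  have hz := norm_nonneg z
  have hc := norm_nonneg c
  generalize ‖z‖ = x at *
  generalize ‖c‖ = k at *
  have e1 : Real.log (1 + w ^ 2) ≤ Real.log (4 + 4 * k ^ 2) + 2 * Real.log (1 + x ^ 2) := by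
    have : Real.log (1 + w ^ 2) ≤ Real.log ((4 + 4 * k ^ 2) * (1 + x ^ 2) ^ 2) := by
      apply Real.log_le_log (by positivity)
      have : w ^ 2 ≤ (x ^ 2 + k) ^ 2 := by gcongr
      nlinarith [sq_nonneg (x ^ 2 - k), sq_nonneg (k * x), sq_nonneg (k * x ^ 2), sq_nonneg x]
    rw [Real.log_mul (by positivity) (by positivity), Real.log_pow] at this
    exact_mod_cast this
  have e2 : 2 * Real.log (1 + x ^ 2) ≤ Real.log (4 + 4 * k ^ 2) + Real.log (1 + w ^ 2) := by
    have : Real.log ((1 + x ^ 2) ^ 2) ≤ Real.log ((4 + 4 * k ^ 2) * (1 + w ^ 2)) := by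
      apply Real.log_le_log (by positivity)
      have : (x ^ 2) ^ 2 ≤ (w + k) ^ 2 := by gcongr
      nlinarith [sq_nonneg (w - k), sq_nonneg (x ^ 2 - 1), sq_nonneg (k * w), sq_nonneg w]
    rw [Real.log_mul (by positivity) (by positivity), Real.log_pow] at this
    exact_mod_cast this
  rw [abs_le]
  constructor <;> linarith

lemma abs_posLog_sub_smoothLog (z : ℂ) :
    |Real.posLog ‖z‖ - smoothLog z| ≤ 1 / 2 * Real.log 2 := by
  rw [Real.posLog_eq_log_max_one (norm_nonneg z)]
  unfold smoothLog
  rw [Complex.normSq_eq_norm_sq]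
  have hz := norm_nonneg z
  generalize ‖z‖ = x at *
  have h1 : Real.log (1 + x ^ 2) ≤ Real.log (2 * (max 1 x) ^ 2) := by
    apply Real.log_le_log (by positivity)
    rcases le_total 1 x with h | h
    · rw [max_eq_right h]; nlinarith
    · rw [max_eq_left h]; nlinarith
  have h2 : Real.log ((max 1 x) ^ 2) ≤ Real.log (1 + x ^ 2) := by
    apply Real.log_le_log (by positivity)
    rcases le_total 1 x with h | h
    · rw [max_eq_right h]; nlinarith
    · rw [max_eq_left h]; nlinarith
  have h3 : (0 : ℝ) < max 1 x := lt_max_of_lt_left one_pos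
  rw [Real.log_mul (by norm_num) (by positivity)] at h1
  rw [Real.log_pow] at h1 h2
  push_cast at h1 h2
  have := Real.log_nonneg (show (1 : ℝ) ≤ 2 by norm_num)
  rw [abs_le]
  constructor <;> linarith

lemma dist_approxRate_succ (c z : ℂ) (n : ℕ) :
    dist (approxRate c n z) (approxRate c (n + 1) z) ≤ growthConst c / 2 / 2 ^ n := by
  have h := abs_smoothLog_quadraticMap_sub c ((quadraticMap c)^[n] z)
  rw [dist_comm, Real.dist_eq]
  unfold approxRate
  rw [Function.iterate_succ_apply']
  have : ∀ a b : ℝ, 1 / 2 ^ (n + 1) * a - 1 / 2 ^ n * b = (a - 2 * b) / 2 / 2 ^ n := by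
    intro a b
    rw [pow_succ]
    field_simp
  rw [this, abs_div, abs_div, abs_of_pos (show (0 : ℝ) < 2 by norm_num),
    abs_of_pos (show (0 : ℝ) < 2 ^ n by positivity)]
  gcongr

lemma exists_tendsto_approxRate (c z : ℂ) :
    ∃ l, Tendsto (fun n => approxRate c n z) atTop (𝓝 l) :=
  cauchySeq_tendsto_of_complete (cauchySeq_of_le_geometric_two (dist_approxRate_succ c z))

lemma tendsto_posLog_of_tendsto_approxRate {c z : ℂ} {l : ℝ}
    (h : Tendsto (fun n => approxRate c n z) atTop (𝓝 l)) :
    Tendsto (fun n : ℕ => 1 / 2 ^ n * Real.posLog ‖(quadraticMap c)^[n] z‖) atTop (𝓝 l) := by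
  have hz : Tendsto (fun n : ℕ => 1 / 2 ^ n * Real.posLog ‖(quadraticMap c)^[n] z‖
      - approxRate c n z) atTop (𝓝 0) := by
    have h0 : Tendsto (fun n : ℕ => (1 / 2 : ℝ) ^ n * (1 / 2 * Real.log 2)) atTop (𝓝 0) := by
      simpa using (tendsto_pow_atTop_nhds_zero_of_lt_one (r := (1 / 2 : ℝ)) (by norm_num)
        (by norm_num)).mul_const (1 / 2 * Real.log 2)
    refine squeeze_zero_norm (fun n => ?_) h0
    unfold approxRate
    rw [← mul_sub, norm_mul, Real.norm_eq_abs, Real.norm_eq_abs,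
      abs_of_pos (show (0 : ℝ) < 1 / 2 ^ n by positivity), div_pow, one_pow]
    gcongr
    exact abs_posLog_sub_smoothLog _
  simpa using hz.add h

end QuadraticEnergy

open QuadraticEnergy in
theorem tendsto_escapeRate (c z : ℂ) :
    Tendsto (fun n : ℕ => 1 / 2 ^ n * Real.posLog ‖(quadraticMap c)^[n] z‖) atTop
      (𝓝 (escapeRate c z)) :=
  tendsto_nhds_limUnder
    ((exists_tendsto_approxRate c z).imp fun _ h => tendsto_posLog_of_tendsto_approxRate h)

namespace QuadraticEnergy

lemma dist_approxRate_escapeRate (c z : ℂ) (n : ℕ) :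
    dist (approxRate c n z) (escapeRate c z) ≤ growthConst c / 2 ^ n := by
  obtain ⟨l, hl⟩ := exists_tendsto_approxRate c z
  have : escapeRate c z = l :=
    tendsto_nhds_unique (tendsto_escapeRate c z) (tendsto_posLog_of_tendsto_approxRate hl)
  rw [this]
  exact dist_le_of_le_geometric_two_of_tendsto (dist_approxRate_succ c z) hl n

lemma contDiff_quadraticMap_iterate (c : ℂ) (n : ℕ) :
    ContDiff ℂ ∞ (quadraticMap c)^[n] := by
  induction n with
  | zero => exact contDiff_id
  | succ n ih =>
    rw [Function.iterate_succ']
    have : ContDiff ℂ ∞ (quadraticMap c) := by unfold quadraticMap; fun_prop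
    exact this.comp ih

lemma contDiff_log_one_add_normSq {h : ℂ → ℂ} (hh : ContDiff ℂ ∞ h) :
    ContDiff ℝ ∞ fun z => Real.log (1 + Complex.normSq (h z)) := by
  have h' : ContDiff ℝ ∞ h := hh.restrict_scalars ℝ
  have : ContDiff ℝ ∞ fun z => 1 + Complex.normSq (h z) := by
    simp only [Complex.normSq_eq_norm_sq]
    exact contDiff_const.add (h'.norm_sq ℝ)
  exact this.log fun z => by have := Complex.normSq_nonneg (h z); positivity

lemma contDiff_approxRate (c : ℂ) (n : ℕ) : ContDiff ℝ ∞ (approxRate c n) := by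
  unfold approxRate smoothLog
  exact contDiff_const.mul (contDiff_const.mul
    (contDiff_log_one_add_normSq (contDiff_quadraticMap_iterate c n)))

lemma continuous_escapeRate (c : ℂ) : Continuous (escapeRate c) := by
  have hu : TendstoUniformly (approxRate c) (escapeRate c) atTop := by
    rw [Metric.tendstoUniformly_iff]
    intro ε hε
    have h0 : Tendsto (fun n : ℕ => growthConst c / 2 ^ n) atTop (𝓝 0) := by
      simpa [div_eq_mul_inv] using (tendsto_pow_atTop_nhds_zero_of_lt_one (r := (1 / 2 : ℝ))
        (by norm_num) (by norm_num)).const_mul (growthConst c)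
    filter_upwards [h0.eventually_lt_const hε] with n hn z
    rw [dist_comm]
    exact (dist_approxRate_escapeRate c z n).trans_lt hn
  exact hu.continuous (Frequently.of_forall fun n => (contDiff_approxRate c n).continuous)

end QuadraticEnergy

open Laplacian in
/-- `μ` is the measure `(1 / 2π) Δ u` on `ℂ`, the Laplacian being taken in the sense of
distributions. -/
structure IsDistribLaplacian (u : ℂ → ℝ) (μ : Measure ℂ) : Prop where
  isLocallyFinite : IsLocallyFiniteMeasure μ
  integral_eq : ∀ φ : ℂ → ℝ, ContDiff ℝ ∞ φ → HasCompactSupport φ →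
    ∫ z, φ z ∂μ = 1 / (2 * π) * ∫ z, u z * (Δ φ) z

namespace QuadraticEnergy

open Laplacian

lemma laplacian_eq_fderiv {g : ℂ → ℝ} (hg : ContDiff ℝ ∞ g) (z : ℂ) :
    (Δ g) z = fderiv ℝ (fun x => fderiv ℝ g x 1) z 1 +
      fderiv ℝ (fun x => fderiv ℝ g x Complex.I) z Complex.I := by
  have hd : DifferentiableAt ℝ (fderiv ℝ g) z :=
    (hg.fderiv_right (m := 1) (by norm_cast)).differentiable (by norm_num) z
  rw [InnerProductSpace.laplacian_eq_iteratedFDeriv_complexPlane]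
  simp only [iteratedFDeriv_two_apply]
  rw [fderiv_clm_apply hd (differentiableAt_const _), fderiv_clm_apply hd (differentiableAt_const _)]
  simp

lemma contDiff_fderiv_apply {g : ℂ → ℝ} (hg : ContDiff ℝ ∞ g) (v : ℂ) :
    ContDiff ℝ ∞ fun x => fderiv ℝ g x v :=
  (hg.fderiv_right (m := ∞) (by norm_cast)).clm_apply contDiff_const

lemma integral_mul_fderiv {f g : ℂ → ℝ} (hf : ContDiff ℝ ∞ f) (hg : ContDiff ℝ ∞ g)
    (h : HasCompactSupport f ∨ HasCompactSupport g) (v : ℂ) :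
    ∫ x, f x * fderiv ℝ g x v = - ∫ x, fderiv ℝ f x v * g x := by
  have hf' := (contDiff_fderiv_apply hf v).continuous
  have hg' := (contDiff_fderiv_apply hg v).continuous
  have key : ∀ a b : ℂ → ℝ, Continuous a → Continuous b →
      (HasCompactSupport a ∨ HasCompactSupport b) → Integrable fun x => a x * b x := by
    intro a b ha hb hab
    refine (ha.mul hb).integrable_of_hasCompactSupport ?_
    rcases hab with hab | hab
    · exact hab.mul_right
    · exact hab.mul_left
  refine integral_mul_fderiv_eq_neg_fderiv_mul_of_integrable (key _ _ hf' hg.continuous ?_)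
    (key _ _ hf.continuous hg' ?_) (key _ _ hf.continuous hg.continuous h)
    (fun x _ => hf.differentiable (by simp) x) (fun x _ => hg.differentiable (by simp) x)
  · exact h.imp (fun h => h.fderiv_apply (𝕜 := ℝ) v) id
  · exact h.imp id (fun h => h.fderiv_apply (𝕜 := ℝ) v)

lemma continuous_laplacian {φ : ℂ → ℝ} (hφ : ContDiff ℝ ∞ φ) : Continuous (Δ φ) := by
  rw [funext (laplacian_eq_fderiv hφ)]
  exact (contDiff_fderiv_apply (contDiff_fderiv_apply hφ _) _).continuous.add
    (contDiff_fderiv_apply (contDiff_fderiv_apply hφ _) _).continuous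

lemma hasCompactSupport_laplacian {φ : ℂ → ℝ} (hφ : ContDiff ℝ ∞ φ) (h : HasCompactSupport φ) :
    HasCompactSupport (Δ φ) := by
  rw [funext (laplacian_eq_fderiv hφ)]
  exact ((h.fderiv_apply (𝕜 := ℝ) _).fderiv_apply (𝕜 := ℝ) _).add
    ((h.fderiv_apply (𝕜 := ℝ) _).fderiv_apply (𝕜 := ℝ) _)

lemma integrable_mul_laplacian {u φ : ℂ → ℝ} (hu : Continuous u) (hφ : ContDiff ℝ ∞ φ)
    (h : HasCompactSupport φ) : Integrable fun z => u z * (Δ φ) z :=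
  (hu.mul (continuous_laplacian hφ)).integrable_of_hasCompactSupport
    (hasCompactSupport_laplacian hφ h).mul_left

lemma integral_mul_laplacian {g φ : ℂ → ℝ} (hg : ContDiff ℝ ∞ g) (hφ : ContDiff ℝ ∞ φ)
    (h : HasCompactSupport φ) : ∫ z, g z * (Δ φ) z = ∫ z, (Δ g) z * φ z := by
  have key : ∀ v : ℂ, ∫ z, g z * fderiv ℝ (fun x => fderiv ℝ φ x v) z v
      = ∫ z, fderiv ℝ (fun x => fderiv ℝ g x v) z v * φ z := by
    intro v
    rw [integral_mul_fderiv hg (contDiff_fderiv_apply hφ v) (.inr (h.fderiv_apply (𝕜 := ℝ) v)),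
      integral_mul_fderiv (contDiff_fderiv_apply hg v) hφ (.inr h), neg_neg]
  have i1 : ∀ v : ℂ, Integrable fun z => g z * fderiv ℝ (fun x => fderiv ℝ φ x v) z v := fun v =>
    (hg.continuous.mul
      (contDiff_fderiv_apply (contDiff_fderiv_apply hφ v) v).continuous).integrable_of_hasCompactSupport
      ((h.fderiv_apply (𝕜 := ℝ) v).fderiv_apply (𝕜 := ℝ) v).mul_left
  have i2 : ∀ v : ℂ, Integrable fun z => fderiv ℝ (fun x => fderiv ℝ g x v) z v * φ z := fun v =>
    ((contDiff_fderiv_apply (contDiff_fderiv_apply hg v) v).continuous.mul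
      hφ.continuous).integrable_of_hasCompactSupport h.mul_left
  simp only [laplacian_eq_fderiv hg, laplacian_eq_fderiv hφ, mul_add, add_mul]
  rw [integral_add (i1 _) (i1 _), integral_add (i2 _) (i2 _), key, key]

lemma fderiv_log_one_add_normSq {h : ℂ → ℂ} (hh : ContDiff ℂ ∞ h) (v z : ℂ) :
    fderiv ℝ (fun z => Real.log (1 + Complex.normSq (h z))) z v
      = 2 * ((starRingEnd ℂ) (h z) * (deriv h z * v)).re / (1 + Complex.normSq (h z)) := by
  have hd : HasFDerivAt h ((ContinuousLinearMap.toSpanSingleton ℂ (deriv h z)).restrictScalars ℝ) z :=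
    ((hh.differentiable (by simp) z).hasDerivAt.hasFDerivAt).restrictScalars ℝ
  have hq : (0 : ℝ) < 1 + Complex.normSq (h z) := by
    have := Complex.normSq_nonneg (h z); positivity
  have h1 := ((hd.norm_sq).const_add 1).log (by rw [← Complex.normSq_eq_norm_sq]; exact hq.ne')
  simp only [← Complex.normSq_eq_norm_sq] at h1
  rw [h1.fderiv]
  simp [div_eq_inv_mul]
  left
  ring

lemma laplacian_log_one_add_normSq_nonneg {h : ℂ → ℂ} (hh : ContDiff ℂ ∞ h) (z : ℂ) :
    0 ≤ (Δ fun z => Real.log (1 + Complex.normSq (h z))) z := by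
  have hq : ∀ z, (0 : ℝ) < 1 + Complex.normSq (h z) := fun z => by
    have := Complex.normSq_nonneg (h z); positivity
  have hh' : ContDiff ℂ ∞ (deriv h) := by
    exact ((contDiff_infty_iff_deriv (𝕜 := ℂ)).1 hh).2
  have second : ∀ v : ℂ, fderiv ℝ
      (fun x => fderiv ℝ (fun z => Real.log (1 + Complex.normSq (h z))) x v) z v =
      2 * (((starRingEnd ℂ) (deriv h z * v) * (deriv h z * v)).re +
        ((starRingEnd ℂ) (h z) * (deriv (deriv h) z * v * v)).re) / (1 + Complex.normSq (h z))
      - (2 * ((starRingEnd ℂ) (h z) * (deriv h z * v)).re) ^ 2 / (1 + Complex.normSq (h z)) ^ 2 := by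
    intro v
    simp only [fderiv_log_one_add_normSq hh]
    have line : HasDerivAt (fun t : ℝ => z + t * v) v 0 := by
      simpa using ((Complex.ofRealCLM.hasDerivAt (x := (0 : ℝ))).mul_const v).const_add z
    have hz : z = z + ((0 : ℝ) : ℂ) * v := by simp
    have along : ∀ k : ℂ → ℂ, ContDiff ℂ ∞ k →
        HasDerivAt (fun t : ℝ => k (z + t * v)) (deriv k z * v) 0 := by
      intro k hk
      have := (hk.differentiable (by simp) (z + ((0 : ℝ) : ℂ) * v)).hasDerivAt.comp (0 : ℝ) line
      rwa [← hz] at this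
    have h0 := along h hh
    have h1 := (along _ hh').mul_const v
    have hnum := Complex.reCLM.hasFDerivAt.comp_hasDerivAt (0 : ℝ) (h0.star.mul h1)
    have hden := (h0.norm_sq).const_add (1 : ℝ)
    have hquot := (hnum.const_mul 2).div hden (by
      rw [← Complex.normSq_eq_norm_sq]; exact (hq _).ne')
    have hG : Differentiable ℝ fun x => 2 * ((starRingEnd ℂ) (h x) * (deriv h x * v)).re /
        (1 + Complex.normSq (h x)) := by
      have := (contDiff_fderiv_apply (contDiff_log_one_add_normSq hh) v).differentiable (by simp)
      simpa only [fderiv_log_one_add_normSq hh] using this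
    have hG' := ((hG (z + ((0 : ℝ) : ℂ) * v)).hasFDerivAt).comp_hasDerivAt (0 : ℝ) line
    rw [← hz] at hG'
    simp only [← Complex.normSq_eq_norm_sq] at hquot
    rw [hG'.unique hquot]
    simp only [Complex.ofReal_zero, zero_mul, add_zero, Complex.reCLM_apply, Function.comp_apply]
    have := (hq z).ne'
    field_simp
    simp [Complex.inner, pow_two]
    ring
  rw [laplacian_eq_fderiv (contDiff_log_one_add_normSq hh), second, second]
  have h0 := hq z
  generalize h z = b at *
  generalize deriv h z = a at *
  generalize deriv (deriv h) z = d at *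
  have : (0 : ℝ) ≤ 4 * Complex.normSq a / (1 + Complex.normSq b) ^ 2 := by
    have := Complex.normSq_nonneg a
    positivity
  refine this.trans_eq ?_
  field_simp
  simp [Complex.normSq_apply]
  ring

lemma laplacian_approxRate_nonneg (c : ℂ) (n : ℕ) (z : ℂ) : 0 ≤ (Δ (approxRate c n)) z := by
  have hh := contDiff_quadraticMap_iterate c n
  have : approxRate c n = (1 / 2 ^ n * (1 / 2) : ℝ) •
      fun z => Real.log (1 + Complex.normSq ((quadraticMap c)^[n] z)) := by
    ext z
    simp [approxRate, smoothLog, mul_assoc]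
  rw [this, InnerProductSpace.laplacian_smul _
    ((contDiff_log_one_add_normSq hh).of_le (by norm_cast)).contDiffAt]
  exact mul_nonneg (by positivity) (laplacian_log_one_add_normSq_nonneg hh z)

/-- The escape rate is subharmonic in the sense of distributions. -/
lemma integral_escapeRate_mul_laplacian_nonneg (c : ℂ) {φ : ℂ → ℝ} (hφ : ContDiff ℝ ∞ φ)
    (h : HasCompactSupport φ) (h0 : ∀ z, 0 ≤ φ z) : 0 ≤ ∫ z, escapeRate c z * (Δ φ) z := by
  have hn : ∀ n, 0 ≤ ∫ z, approxRate c n z * (Δ φ) z := fun n => by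
    rw [integral_mul_laplacian (contDiff_approxRate c n) hφ h]
    exact integral_nonneg fun z => mul_nonneg (laplacian_approxRate_nonneg c n z) (h0 z)
  have hlim : Tendsto (fun n => ∫ z, approxRate c n z * (Δ φ) z) atTop
      (𝓝 (∫ z, escapeRate c z * (Δ φ) z)) := by
    have hΔ : Integrable fun z => ‖(Δ φ) z‖ :=
      ((continuous_laplacian hφ).integrable_of_hasCompactSupport
        (hasCompactSupport_laplacian hφ h)).norm
    have hz : Tendsto (fun n : ℕ => growthConst c / 2 ^ n * ∫ z, ‖(Δ φ) z‖) atTop (𝓝 0) := by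
      have : Tendsto (fun n : ℕ => growthConst c * (1 / 2 : ℝ) ^ n * ∫ z, ‖(Δ φ) z‖) atTop
          (𝓝 (growthConst c * 0 * ∫ z, ‖(Δ φ) z‖)) :=
        ((tendsto_pow_atTop_nhds_zero_of_lt_one (by norm_num) (by norm_num)).const_mul _).mul_const _
      simpa [div_eq_mul_inv] using this
    rw [tendsto_iff_norm_sub_tendsto_zero]
    refine squeeze_zero (fun _ => norm_nonneg _) (fun n => ?_) hz
    rw [← integral_sub (integrable_mul_laplacian (contDiff_approxRate c n).continuous hφ h)
      (integrable_mul_laplacian (continuous_escapeRate c) hφ h), ← integral_const_mul]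
    refine norm_integral_le_of_norm_le (hΔ.const_mul _) (Eventually.of_forall fun z => ?_)
    rw [← sub_mul, norm_mul]
    have := dist_approxRate_escapeRate c z n
    rw [dist_eq_norm] at this
    gcongr
  exact ge_of_tendsto' hlim hn

open scoped CompactlySupported

/-- A continuous function whose distributional Laplacian is nonnegative on nonnegative test
functions has a Radon measure as its distributional Laplacian. -/
lemma exists_isDistribLaplacian {u : ℂ → ℝ} (hu : Continuous u)
    (hpos : ∀ φ : ℂ → ℝ, ContDiff ℝ ∞ φ → HasCompactSupport φ → (∀ z, 0 ≤ φ z) →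
      0 ≤ ∫ z, u z * (Δ φ) z) : ∃ μ : Measure ℂ, IsDistribLaplacian u μ := by
  have le2 : ∀ {φ : ℂ → ℝ}, ContDiff ℝ ∞ φ → ContDiff ℝ 2 φ := fun h => h.of_le (by norm_cast)
  let p : Submodule ℝ C_c(ℂ, ℝ) :=
    { carrier := {φ | ContDiff ℝ ∞ (φ : ℂ → ℝ)}
      add_mem' := fun {a b} ha hb => by
        simp only [Set.mem_ofPred_eq, CompactlySupportedContinuousMap.coe_add] at *
        exact ContDiff.add ha hb
      zero_mem' := by
        simp only [Set.mem_ofPred_eq, CompactlySupportedContinuousMap.coe_zero]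
        exact contDiff_const
      smul_mem' := fun r a ha => by
        simp only [Set.mem_ofPred_eq, CompactlySupportedContinuousMap.coe_smul] at *
        exact contDiff_const.smul ha }
  have hp : ∀ φ : p, ContDiff ℝ ∞ (φ.1 : ℂ → ℝ) := fun φ => φ.2
  let T : p →ₗ[ℝ] ℝ :=
    { toFun := fun φ => 1 / (2 * π) * ∫ z, u z * (Δ (φ.1 : ℂ → ℝ)) z
      map_add' := fun a b => by
        have h : (Δ ((a + b).1 : ℂ → ℝ))
            = fun z => (Δ (a.1 : ℂ → ℝ)) z + (Δ (b.1 : ℂ → ℝ)) z := by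
          ext z
          exact (le2 (hp a)).contDiffAt.laplacian_add (le2 (hp b)).contDiffAt
        simp only [h, mul_add]
        rw [integral_add (integrable_mul_laplacian hu (hp a) a.1.hasCompactSupport)
          (integrable_mul_laplacian hu (hp b) b.1.hasCompactSupport), mul_add]
      map_smul' := fun r a => by
        have h : (Δ ((r • a).1 : ℂ → ℝ)) = fun z => r * (Δ (a.1 : ℂ → ℝ)) z := by
          ext z
          exact InnerProductSpace.laplacian_smul r (le2 (hp a)).contDiffAt
        simp only [h, mul_left_comm _ r, integral_const_mul]
        simp }
  let s : PointedCone ℝ C_c(ℂ, ℝ) :=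
    { carrier := {f | ∀ z, 0 ≤ f z}
      add_mem' := fun {a b} ha hb => by
        simp only [Set.mem_ofPred_eq] at *
        exact fun z => add_nonneg (ha z) (hb z)
      zero_mem' := by simp
      smul_mem' := fun r a ha => by
        simp only [Set.mem_ofPred_eq] at *
        exact fun z => mul_nonneg r.2 (ha z) }
  have hs : ∀ f, f ∈ s ↔ ∀ z, 0 ≤ f z := fun _ => Iff.rfl
  obtain ⟨g, hg, hg0⟩ := riesz_extension s ⟨p, T⟩ (by
      intro φ hφ
      exact mul_nonneg (by positivity) (hpos _ (hp φ) φ.1.hasCompactSupport hφ)) (by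
      intro f
      obtain ⟨M, hM⟩ := f.hasCompactSupport.exists_bound_of_continuous f.continuous
      obtain ⟨R, hR, hfR⟩ := f.hasCompactSupport.isBounded.subset_closedBall_lt 0 0
      let B : ContDiffBump (0 : ℂ) := ⟨R, R + 1, hR, by linarith⟩
      have hB : ContDiff ℝ ∞ fun z => M * B z := contDiff_const.mul B.contDiff
      refine ⟨⟨⟨⟨fun z => M * B z, hB.continuous⟩, B.hasCompactSupport.mul_left⟩, hB⟩,
        fun z => ?_⟩
      have hM0 : 0 ≤ M := (norm_nonneg _).trans (hM 0)
      change 0 ≤ M * B z + f z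
      by_cases hz : z ∈ tsupport f
      · rw [B.one_of_mem_closedBall (hfR hz), mul_one]
        have := (abs_le.1 (hM z)).1
        linarith
      · rw [image_eq_zero_of_notMem_tsupport hz, add_zero]
        exact mul_nonneg hM0 B.nonneg)
  let Λ : C_c(ℂ, ℝ) →ₚ[ℝ] ℝ := PositiveLinearMap.mk₀ g fun f hf => hg0 f fun z => hf z
  refine ⟨RealRMK.rieszMeasure Λ, inferInstance, fun φ hφ hc => ?_⟩
  have h := RealRMK.integral_rieszMeasure Λ ⟨⟨φ, hφ.continuous⟩, hc⟩
  refine h.trans ?_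
  exact hg ⟨⟨⟨φ, hφ.continuous⟩, hc⟩, hφ⟩

/-- A distributional Laplacian determines the measure. -/
lemma isDistribLaplacian_unique {u : ℂ → ℝ} {μ ν : Measure ℂ} (hμ : IsDistribLaplacian u μ)
    (hν : IsDistribLaplacian u ν) : μ = ν := by
  have := hμ.isLocallyFinite
  have := hν.isLocallyFinite
  refine Measure.ext_of_integral_eq_on_compactlySupported fun f => ?_
  have hK : IsCompact (tsupport f) := f.hasCompactSupport
  have close : ∀ (m : Measure ℂ) [IsLocallyFiniteMeasure m] (g : ℂ → ℝ) (ε : ℝ), Continuous g →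
      HasCompactSupport g → Function.support g ⊆ Function.support f →
      (∀ z, dist (g z) (f z) < ε) →
      |∫ z, f z ∂m - ∫ z, g z ∂m| ≤ ε * m.real (tsupport f) := by
    intro m _ g ε hg hgc hgs hd
    have hf : Integrable (fun z => f z) m :=
      f.continuous.integrable_of_hasCompactSupport f.hasCompactSupport
    have hgi : Integrable g m := hg.integrable_of_hasCompactSupport hgc
    rw [← integral_sub hf hgi, ← Real.norm_eq_abs,
      ← setIntegral_eq_integral_of_forall_compl_eq_zero (s := tsupport f)]
    · refine norm_setIntegral_le_of_norm_le_const (μ := m) (hK.measure_lt_top (μ := m)) fun z _ => ?_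
      rw [← dist_eq_norm, dist_comm]
      exact (hd z).le
    · intro z hz
      have h1 : f z = 0 := image_eq_zero_of_notMem_tsupport hz
      have h2 : g z = 0 := by
        by_contra h
        exact hgs h h1
      rw [h1, h2, sub_zero]
  have bound : ∀ ε > 0, |∫ z, f z ∂μ - ∫ z, f z ∂ν|
      ≤ ε * (μ.real (tsupport f) + ν.real (tsupport f)) := by
    intro ε hε
    obtain ⟨g, hg, hd, hgs⟩ := f.continuous.exists_contDiff_approx ⊤ (continuous_const (y := ε))
      fun _ => hε
    have hgc : HasCompactSupport g := HasCompactSupport.of_support_subset_isCompact hK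
      (hgs.trans (subset_tsupport _))
    have e1 := close μ g ε hg.continuous hgc hgs hd
    have e2 := close ν g ε hg.continuous hgc hgs hd
    rw [hμ.integral_eq g hg hgc] at e1
    rw [hν.integral_eq g hg hgc] at e2
    rw [abs_le] at *
    constructor <;> linarith [e1.1, e1.2, e2.1, e2.2]
  have hlim : Tendsto (fun ε : ℝ => ε * (μ.real (tsupport f) + ν.real (tsupport f)))
      (𝓝[>] 0) (𝓝 0) := by
    have : Tendsto (fun ε : ℝ => ε * (μ.real (tsupport f) + ν.real (tsupport f)))
        (𝓝 0) (𝓝 (0 * (μ.real (tsupport f) + ν.real (tsupport f)))) := tendsto_id.mul_const _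
    rw [zero_mul] at this
    exact this.mono_left nhdsWithin_le_nhds
  have := ge_of_tendsto hlim (eventually_mem_nhdsWithin.mono fun ε hε => bound ε hε)
  exact sub_eq_zero.1 (abs_eq_zero.1 (le_antisymm this (abs_nonneg _)))

end QuadraticEnergy

open QuadraticEnergy in
/-- For every `c` there is exactly one measure `(1 / 2π) Δ λ_c`. -/
theorem existsUnique_equilibriumMeasure (c : ℂ) :
    ∃! μ : Measure ℂ, IsDistribLaplacian (escapeRate c) μ := by
  obtain ⟨μ, hμ⟩ := exists_isDistribLaplacian (continuous_escapeRate c)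
    fun _ => integral_escapeRate_mul_laplacian_nonneg c
  exact ⟨μ, hμ, fun _ hν => isDistribLaplacian_unique hν hμ⟩

/-- The equilibrium measure `μ_c = (1 / 2π) Δ λ_c` of `f_c`. -/
noncomputable def equilibriumMeasure (c : ℂ) : Measure ℂ :=
  (existsUnique_equilibriumMeasure c).choose

/-- The Euclidean energy `E_∞(c₁, c₂) = ∫ λ_{c₁} dμ_{c₂}`. -/
noncomputable def archimedeanEnergy (c₁ c₂ : ℂ) : ℝ :=
  ∫ z, escapeRate c₁ z ∂equilibriumMeasure c₂

/-!
The measure `μ_c` is invariant under `f_c` and under `z ↦ -z`: changing variables in the defining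
identity shows that each pushforward of `μ_c` is again a distributional Laplacian of `λ_c`, and such
a measure is unique. It has mass one, because `λ_c(z) - log |z|` tends to `0` at infinity, so
dilated test functions do not distinguish `λ_c` from `½ log (1 + |z|²)`, whose Laplacian integrates
to `2π`. By Poincaré recurrence it is carried by the filled Julia set `λ_c = 0`, since `λ_c` doubles
along orbits.

Put `δ = c₁ - c₂` and `s² = max |cᵢ|`. As `f_{c₁} = f_{c₂} + δ`, invariance turns the energy into
`½ ∫ λ_{c₁}(y + δ) dμ_{c₂}(y) = ¼ ∫ (λ_{c₁}(y + δ) + λ_{c₁}(-y + δ)) dμ_{c₂}(y)`, where `|y|` is at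
most about `s`. If `|δ|` is larger than `3s + 1`, every `y + δ` escapes at rate at least about
`log s`. Otherwise `|y|` is close to `s`, and one of `±y + δ` escapes. Indeed
`f_{c₁}(±y + δ) = A ± B` with `A = f_{c₂}(y) + δ + δ²` and `B = 2yδ`; if both images of `A ± B`
under `f_{c₁}` were small, then `A + B` and `A - B` would each lie near a root `±q` of `q² = -c₁`.
When the two roots agree, `B` is bounded, contradicting `|δ| ≥ 3 / s`. When they are opposite, `A`
is bounded and `|δ| ≤ 1`, contradicting `|f_{c₂}(y)| ≈ s`.
-/

namespace QuadraticEnergy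

open Laplacian InnerProductSpace

/-! ### The Laplacian under composition -/

lemma fderiv_fderiv_comp_apply {𝕜 E E' F : Type*} [NontriviallyNormedField 𝕜]
    [NormedAddCommGroup E] [NormedSpace 𝕜 E] [NormedAddCommGroup E'] [NormedSpace 𝕜 E']
    [NormedAddCommGroup F] [NormedSpace 𝕜 F] {h : E → E'} {φ : E' → F} {x : E}
    (hφ : ContDiffAt 𝕜 2 φ (h x)) (hh : ContDiffAt 𝕜 2 h x) (v w : E) :
    fderiv 𝕜 (fderiv 𝕜 (φ ∘ h)) x v w =
      fderiv 𝕜 (fderiv 𝕜 φ) (h x) (fderiv 𝕜 h x v) (fderiv 𝕜 h x w) +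
        fderiv 𝕜 φ (h x) (fderiv 𝕜 (fderiv 𝕜 h) x v w) := by
  have dh : DifferentiableAt 𝕜 h x := hh.differentiableAt two_ne_zero
  have ddh : DifferentiableAt 𝕜 (fderiv 𝕜 h) x :=
    (hh.fderiv_right (m := 1) le_rfl).differentiableAt one_ne_zero
  have ddφ : DifferentiableAt 𝕜 (fderiv 𝕜 φ) (h x) :=
    (hφ.fderiv_right (m := 1) le_rfl).differentiableAt one_ne_zero
  have chain : fderiv 𝕜 (φ ∘ h) =ᶠ[𝓝 x] fun y => (fderiv 𝕜 φ ∘ h) y ∘SL fderiv 𝕜 h y := by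
    filter_upwards [hh.eventually (by simp),
      hh.continuousAt.eventually (hφ.eventually (by simp))] with y hy hφy
    exact fderiv_comp y (hφy.differentiableAt two_ne_zero) (hy.differentiableAt two_ne_zero)
  rw [chain.fderiv_eq, fderiv_clm_comp (ddφ.comp x dh) ddh, fderiv_comp x ddφ dh]
  simp [add_comm]

lemma laplacian_comp {ι E E' F : Type*} [Fintype ι] [NormedAddCommGroup E] [InnerProductSpace ℝ E]
    [FiniteDimensional ℝ E] [NormedAddCommGroup E'] [NormedSpace ℝ E'] [NormedAddCommGroup F]
    [NormedSpace ℝ F] (b : OrthonormalBasis ι ℝ E) {h : E → E'} {φ : E' → F} {x : E}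
    (hφ : ContDiffAt ℝ 2 φ (h x)) (hh : ContDiffAt ℝ 2 h x) :
    (Δ (φ ∘ h)) x =
      ∑ i, fderiv ℝ (fderiv ℝ φ) (h x) (fderiv ℝ h x (b i)) (fderiv ℝ h x (b i)) +
        fderiv ℝ φ (h x) ((Δ h) x) := by
  simp only [laplacian_eq_iteratedFDeriv_orthonormalBasis _ b, iteratedFDeriv_two_apply,
    Matrix.cons_val_zero, Matrix.cons_val_one, fderiv_fderiv_comp_apply hφ hh,
    Finset.sum_add_distrib, map_sum]

/-- The chain rule for the Laplacian simplifies because holomorphic maps are harmonic and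
conformal. -/
lemma laplacian_comp_of_analyticAt {F : Type*} [NormedAddCommGroup F] [NormedSpace ℝ F]
    {h : ℂ → ℂ} {φ : ℂ → F} {z : ℂ} (hφ : ContDiffAt ℝ 2 φ (h z)) (hh : AnalyticAt ℂ h z) :
    (Δ (φ ∘ h)) z = ‖deriv h z‖ ^ 2 • (Δ φ) (h z) := by
  have hfd : fderiv ℝ h z = (fderiv ℂ h z).restrictScalars ℝ :=
    hh.differentiableAt.fderiv_restrictScalars ℝ
  rw [laplacian_comp Complex.orthonormalBasisOneI hφ (hh.contDiffAt.restrict_scalars ℝ),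
    hh.harmonicAt.2.eq_of_nhds, laplacian_eq_iteratedFDeriv_complexPlane]
  simp only [Complex.coe_orthonormalBasisOneI, Fin.sum_univ_two, Matrix.cons_val_zero,
    Matrix.cons_val_one, hfd, ContinuousLinearMap.coe_restrictScalars', iteratedFDeriv_two_apply,
    fderiv_eq_smul_deriv, Pi.zero_apply, map_zero, add_zero, smul_eq_mul, one_mul]
  generalize deriv h z = a
  have ha : a = a.re • (1 : ℂ) + a.im • Complex.I := by simp
  have hIa : Complex.I * a = (-a.im) • (1 : ℂ) + a.re • Complex.I := by
    apply Complex.ext <;> simp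
  rw [hIa, ← Complex.normSq_eq_norm_sq, Complex.normSq_apply]
  nth_rewrite 1 2 [ha]
  simp only [map_add, map_smul, add_apply, smul_apply]
  module

lemma fderiv_fderiv_norm_sq_apply {E : Type*} [NormedAddCommGroup E] [InnerProductSpace ℝ E]
    (x v w : E) : fderiv ℝ (fderiv ℝ fun y : E => ‖y‖ ^ 2) x v w = 2 * inner ℝ v w := by
  have h : fderiv ℝ (2 • ⇑(innerSL ℝ (E := E))) x = 2 • innerSL ℝ :=
    ContinuousLinearMap.fderiv (2 • innerSL ℝ : E →L[ℝ] E →L[ℝ] ℝ)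
  rw [fderiv_norm_sq, h]
  exact (two_nsmul _).trans (two_mul _).symm

lemma laplacian_comp_norm_sq {E F : Type*} [NormedAddCommGroup E] [InnerProductSpace ℝ E]
    [FiniteDimensional ℝ E] [NormedAddCommGroup F] [NormedSpace ℝ F] {φ : ℝ → F} {x : E}
    (hφ : ContDiffAt ℝ 2 φ (‖x‖ ^ 2)) :
    (Δ fun y : E => φ (‖y‖ ^ 2)) x = (4 * ‖x‖ ^ 2) • iteratedDeriv 2 φ (‖x‖ ^ 2) +
        (2 * Module.finrank ℝ E : ℝ) • deriv φ (‖x‖ ^ 2) := by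
  have b := stdOrthonormalBasis ℝ E
  have hφ'' (v : ℝ) : fderiv ℝ (fderiv ℝ φ) (‖x‖ ^ 2) v v =
      v ^ 2 • iteratedDeriv 2 φ (‖x‖ ^ 2) := by
    have h := iteratedFDeriv_apply_eq_iteratedDeriv_mul_prod (f := φ) (x := ‖x‖ ^ 2) (m := ![v, v])
    simpa [iteratedFDeriv_two_apply, ← sq] using h
  have hD (v : E) : fderiv ℝ (fun y : E => ‖y‖ ^ 2) x v = 2 * inner ℝ x v := by
    simp [fderiv_norm_sq_apply]
  have hΔ : (Δ fun y : E => ‖y‖ ^ 2) x = (2 * Module.finrank ℝ E : ℝ) := by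
    simp [laplacian_eq_iteratedFDeriv_orthonormalBasis _ b, iteratedFDeriv_two_apply,
      fderiv_fderiv_norm_sq_apply, mul_comm]
  have hsum : ∑ i, (2 * inner ℝ x (b i)) ^ 2 = 4 * ‖x‖ ^ 2 := by
    rw [← b.sum_sq_inner_left x, Finset.mul_sum]
    exact Finset.sum_congr rfl fun i _ => by ring
  rw [show (fun y : E => φ (‖y‖ ^ 2)) = φ ∘ fun y => ‖y‖ ^ 2 from rfl,
    laplacian_comp b hφ (contDiff_norm_sq ℝ).contDiffAt, hΔ]
  simp only [hφ'', hD, ← Finset.sum_smul, hsum]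
  rw [fderiv_eq_smul_deriv]

lemma smoothLog_eq_log_norm (z : ℂ) : smoothLog z = 1 / 2 * Real.log (1 + ‖z‖ ^ 2) := by
  rw [smoothLog, Complex.normSq_eq_norm_sq]

lemma contDiff_smoothLog : ContDiff ℝ ∞ smoothLog :=
  contDiff_const.mul (contDiff_log_one_add_normSq contDiff_id)

lemma laplacian_smoothLog (z : ℂ) : (Δ smoothLog) z = 2 / (1 + ‖z‖ ^ 2) ^ 2 := by
  have hpos : 0 < 1 + ‖z‖ ^ 2 := by positivity
  have hderiv (s : ℝ) : deriv (fun t : ℝ => 1 / 2 * Real.log (1 + t)) s = 1 / 2 * (1 + s)⁻¹ := by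
    rw [deriv_const_mul_field, deriv_comp_const_add Real.log, Real.deriv_log]
  have hderiv2 (s : ℝ) : iteratedDeriv 2 (fun t : ℝ => 1 / 2 * Real.log (1 + t)) s =
      -(1 / 2 * ((1 + s) ^ 2)⁻¹) := by
    rw [iteratedDeriv_succ, iteratedDeriv_one, funext hderiv, deriv_const_mul_field,
      deriv_comp_const_add Inv.inv, deriv_inv]
    ring
  rw [funext smoothLog_eq_log_norm, laplacian_comp_norm_sq (φ := fun t => 1 / 2 * Real.log (1 + t)),
    hderiv, hderiv2, Complex.finrank_real_complex]
  · simp only [smul_eq_mul]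
    push_cast
    field_simp
    ring
  · exact contDiffAt_const.mul ((contDiffAt_const.add contDiffAt_id).log hpos.ne')

lemma hasDerivAt_neg_inv_one_add_sq (x : ℝ) :
    HasDerivAt (fun x : ℝ => -(1 + x ^ 2)⁻¹) (x * (2 / (1 + x ^ 2) ^ 2)) x := by
  have hq : (1 + x ^ 2) ≠ 0 := by positivity
  refine (((hasDerivAt_pow 2 x).const_add 1).inv hq).neg.congr_deriv ?_
  push_cast
  ring

lemma tendsto_neg_inv_one_add_sq :
    Tendsto (fun x : ℝ => -(1 + x ^ 2)⁻¹) atTop (𝓝 0) := by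
  have : Tendsto (fun x : ℝ => 1 + x ^ 2) atTop atTop :=
    tendsto_atTop_add_const_left _ _ (tendsto_pow_atTop two_ne_zero)
  simpa using this.inv_tendsto_atTop.neg

lemma integrable_laplacian_smoothLog : Integrable (Δ smoothLog) := by
  rw [funext laplacian_smoothLog]
  refine (integrable_fun_norm_addHaar volume (f := fun x : ℝ => 2 / (1 + x ^ 2) ^ 2)).2 ?_
  simpa using integrableOn_Ioi_deriv_of_nonneg' (a := 0)
    (fun x _ => hasDerivAt_neg_inv_one_add_sq x)
    (fun x hx => mul_nonneg (le_of_lt hx) (by positivity)) tendsto_neg_inv_one_add_sq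

lemma integral_laplacian_smoothLog : ∫ z, (Δ smoothLog) z = 2 * π := by
  have h := integral_Ioi_of_hasDerivAt_of_nonneg' (a := 0)
    (fun x _ => hasDerivAt_neg_inv_one_add_sq x)
    (fun x hx => mul_nonneg (le_of_lt hx) (by positivity)) tendsto_neg_inv_one_add_sq
  simp only [laplacian_smoothLog]
  rw [integral_fun_norm_addHaar volume (fun x : ℝ => 2 / (1 + x ^ 2) ^ 2)]
  simp only [Complex.finrank_real_complex, Nat.add_one_sub_one, pow_one, smul_eq_mul, h]
  simp [Measure.real]

/-! ### Change of variables under squaring -/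

lemma ae_linearMap_ne_zero {E F : Type*} [NormedAddCommGroup E] [NormedSpace ℝ E]
    [MeasurableSpace E] [BorelSpace E] [FiniteDimensional ℝ E] [AddCommGroup F] [Module ℝ F]
    (μ : Measure E) [μ.IsAddHaarMeasure] {l : E →ₗ[ℝ] F} (hl : l ≠ 0) : ∀ᵐ x ∂μ, l x ≠ 0 :=
  measure_mono_null (fun _ hx => not_not.1 hx)
    (Measure.addHaar_submodule μ l.ker fun h => hl (LinearMap.ker_eq_top.1 h))

lemma ae_re_ne_zero : ∀ᵐ z : ℂ, z.re ≠ 0 :=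
  ae_linearMap_ne_zero volume (l := Complex.reLm) fun h => by simpa using congrArg (· 1) h

lemma slitPlane_ae_eq_univ : Complex.slitPlane =ᵐ[volume] (Set.univ : Set ℂ) := by
  have him : ∀ᵐ z : ℂ, z.im ≠ 0 := ae_linearMap_ne_zero volume (l := Complex.imLm) fun h => by
    simpa using congrArg (· Complex.I) h
  exact eventuallyEq_univ.2 (him.mono fun z hz => Complex.mem_slitPlane_iff.2 (.inr hz))

lemma det_toSpanSingleton_restrictScalars (a : ℂ) :
    ((ContinuousLinearMap.toSpanSingleton ℂ a).restrictScalars ℝ).det = ‖a‖ ^ 2 := by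
  rw [← Complex.normSq_eq_norm_sq, ← Algebra.norm_complex_apply, Algebra.norm_apply,
    ContinuousLinearMap.det]
  congr 1
  ext
  simp [mul_comm]

lemma setIntegral_image_of_hasDerivWithinAt {E : Type*} [NormedAddCommGroup E] [NormedSpace ℝ E]
    {f f' : ℂ → ℂ} {s : Set ℂ} (hs : MeasurableSet s)
    (hf : ∀ z ∈ s, HasDerivWithinAt f (f' z) s z) (hinj : Set.InjOn f s) (F : ℂ → E) :
    ∫ w in f '' s, F w = ∫ z in s, ‖f' z‖ ^ 2 • F (f z) := by
  rw [integral_image_eq_integral_abs_det_fderiv_smul volume hs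
    (fun z hz => (hf z hz).hasFDerivWithinAt.restrictScalars ℝ) hinj]
  simp only [det_toSpanSingleton_restrictScalars, abs_pow, abs_norm]

lemma injOn_sq_re_pos : Set.InjOn (fun z : ℂ => z ^ 2) {z | 0 < z.re} := by
  intro a (ha : 0 < a.re) b (hb : 0 < b.re) hab
  refine (sq_eq_sq_iff_eq_or_eq_neg.1 hab).resolve_right ?_
  rintro rfl
  rw [Complex.neg_re] at ha
  linarith

lemma image_sq_re_pos : (fun z : ℂ => z ^ 2) '' {z | 0 < z.re} = Complex.slitPlane := by
  apply Set.Subset.antisymm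
  · rintro _ ⟨z, hz : 0 < z.re, rfl⟩
    change z ^ 2 ∈ _
    rw [Complex.mem_slitPlane_iff, sq, Complex.mul_re, Complex.mul_im]
    by_cases him : z.im = 0
    · exact .inl (by simpa [him] using hz.ne')
    · exact .inr (by simpa [mul_comm z.im, ← two_mul] using ⟨hz.ne', him⟩)
  · intro w hw
    refine ⟨w ^ (2⁻¹ : ℂ), ?_, by simp⟩
    have hre : -‖w‖ < w.re := by
      rcases Complex.mem_slitPlane_iff.1 hw with h | h
      · linarith [norm_nonneg w]
      · exact (abs_lt.1 (Complex.abs_re_lt_norm.2 h)).1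
    rw [Set.mem_ofPred_eq, Complex.cpow_inv_two_re]
    exact Real.sqrt_pos.2 (by linarith)

lemma setIntegral_comp_sq_re_pos {E : Type*} [NormedAddCommGroup E] [NormedSpace ℝ E]
    (F : ℂ → E) : ∫ z in {z : ℂ | 0 < z.re}, ‖2 * z‖ ^ 2 • F (z ^ 2) = ∫ w, F w := by
  rw [← setIntegral_image_of_hasDerivWithinAt (f := fun z => z ^ 2)
      (measurableSet_lt measurable_const Complex.measurable_re)
      (fun z _ => by simpa using (hasDerivAt_pow 2 z).hasDerivWithinAt) injOn_sq_re_pos,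
    image_sq_re_pos, setIntegral_congr_set slitPlane_ae_eq_univ, setIntegral_univ]

lemma integral_comp_sq {E : Type*} [NormedAddCommGroup E] [NormedSpace ℝ E] {F : ℂ → E}
    (hF : Integrable fun z => ‖2 * z‖ ^ 2 • F (z ^ 2)) :
    ∫ z : ℂ, ‖2 * z‖ ^ 2 • F (z ^ 2) = (2 : ℝ) • ∫ w, F w := by
  have hmeas : MeasurableSet {z : ℂ | 0 < z.re} :=
    measurableSet_lt measurable_const Complex.measurable_re
  have hcompl : ({z | 0 < z.re}ᶜ : Set ℂ) =ᵐ[volume] (Neg.neg ⁻¹' {z | 0 < z.re} : Set ℂ) := by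
    filter_upwards [ae_re_ne_zero] with z hz
    simp only [eq_iff_iff]
    change ¬ 0 < z.re ↔ 0 < (-z).re
    rw [Complex.neg_re, Left.neg_pos_iff, not_lt, le_iff_lt_or_eq, or_iff_left hz]
  rw [← integral_add_compl hmeas hF, setIntegral_congr_set hcompl]
  have h := (Measure.measurePreserving_neg (volume : Measure ℂ)).setIntegral_preimage_emb
    (MeasurableEquiv.neg ℂ).measurableEmbedding (fun z => ‖2 * z‖ ^ 2 • F (z ^ 2)) {z | 0 < z.re}
  simp only [mul_neg, norm_neg, even_two.neg_pow] at h
  rw [h, setIntegral_comp_sq_re_pos, two_smul]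

/-! ### Distributional Laplacians -/

lemma hasCompactSupport_comp_of_isProperMap {X Y M : Type*} [TopologicalSpace X] [R1Space X]
    [TopologicalSpace Y] [Zero M] {φ : Y → M} {h : X → Y} (hφ : HasCompactSupport φ)
    (hh : IsProperMap h) : HasCompactSupport (φ ∘ h) :=
  HasCompactSupport.intro (hh.isCompact_preimage hφ)
    fun x hx => image_eq_zero_of_notMem_tsupport (f := φ) (x := h x) hx

lemma tendsto_integral_mul_comp_smul {E : Type*} [NormedAddCommGroup E] [NormedSpace ℝ E]
    [MeasurableSpace E] [BorelSpace E] {μ : Measure E} {g φ : E → ℝ} (hg : Integrable g μ)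
    (hφ : Continuous φ) (hc : HasCompactSupport φ) :
    Tendsto (fun t : ℝ => ∫ x, g x * φ (t • x) ∂μ) (𝓝[≠] 0) (𝓝 ((∫ x, g x ∂μ) * φ 0)) := by
  obtain ⟨C, hC⟩ := hφ.bounded_above_of_compact_support hc
  rw [← integral_mul_const]
  refine tendsto_integral_filter_of_dominated_convergence (fun x => ‖g x‖ * C)
    (.of_forall fun t => hg.aestronglyMeasurable.mul
      (hφ.comp (continuous_const_smul t)).aestronglyMeasurable)
    (.of_forall fun t => .of_forall fun x => ?_) (hg.norm.mul_const C) (.of_forall fun x => ?_)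
  · rw [norm_mul]
    gcongr
    exact hC _
  · have : Continuous fun t : ℝ => g x * φ (t • x) := by fun_prop
    simpa using (this.tendsto 0).mono_left nhdsWithin_le_nhds

lemma exists_norm_le_of_tendsto_cocompact {X E : Type*} [TopologicalSpace X]
    [SeminormedAddCommGroup E] {v : X → E} {a : E} (hv : Continuous v)
    (hlim : Tendsto v (cocompact X) (𝓝 a)) : ∃ C, ∀ x, ‖v x‖ ≤ C := by
  obtain ⟨M, hM⟩ := hlim.norm.isBoundedUnder_le
  obtain ⟨K, hK, hKM⟩ := mem_cocompact.1 (eventually_map.1 hM)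
  obtain ⟨C, hC⟩ := hK.exists_bound_of_continuousOn hv.continuousOn
  refine ⟨max C M, fun x => ?_⟩
  by_cases hx : x ∈ K
  · exact (hC x hx).trans (le_max_left _ _)
  · exact (hKM hx).trans (le_max_right _ _)

lemma tendsto_inv_smul_cocompact {E : Type*} [NormedAddCommGroup E] [NormedSpace ℝ E] {x : E}
    (hx : x ≠ 0) : Tendsto (fun t : ℝ => t⁻¹ • x) (𝓝[≠] 0) (cocompact E) := by
  refine Tendsto.mono_right ?_ (Metric.cobounded_le_cocompact)
  rw [← tendsto_norm_atTop_iff_cobounded]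
  simp only [norm_smul]
  exact (tendsto_norm_cobounded_atTop.comp tendsto_inv₀_nhdsNE_zero).atTop_mul_const
    (norm_pos_iff.2 hx)

lemma tendsto_integral_comp_inv_smul_mul {E : Type*} [NormedAddCommGroup E] [NormedSpace ℝ E]
    [MeasurableSpace E] [BorelSpace E] {μ : Measure E} [NullSingletonClass μ] {v ψ : E → ℝ}
    {a : ℝ} (hv : Continuous v) (hlim : Tendsto v (cocompact E) (𝓝 a)) (hψ : Integrable ψ μ) :
    Tendsto (fun t : ℝ => ∫ x, v (t⁻¹ • x) * ψ x ∂μ) (𝓝[≠] 0) (𝓝 (a * ∫ x, ψ x ∂μ)) := by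
  obtain ⟨C, hC⟩ : ∃ C, ∀ x, ‖v x‖ ≤ C := exists_norm_le_of_tendsto_cocompact hv hlim
  rw [← integral_const_mul]
  refine tendsto_integral_filter_of_dominated_convergence (fun x => C * ‖ψ x‖)
    (.of_forall fun t => (hv.comp (continuous_const_smul _)).aestronglyMeasurable.mul
      hψ.aestronglyMeasurable)
    (.of_forall fun t => .of_forall fun x => ?_) (hψ.norm.const_mul C) ?_
  · rw [norm_mul]
    gcongr
    exact hC _
  · filter_upwards [Measure.ae_ne μ 0] with x hx
    exact (hlim.comp (tendsto_inv_smul_cocompact hx)).mul_const _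

lemma isProbabilityMeasure_of_tendsto_integral_comp_smul {E : Type*} [NormedAddCommGroup E]
    [NormedSpace ℝ E] [MeasurableSpace E] [BorelSpace E] {μ : Measure E}
    [IsFiniteMeasureOnCompacts μ]
    {φ : E → ℝ} (hφ : Continuous φ) (hc : HasCompactSupport φ) (hnonneg : ∀ x, 0 ≤ φ x)
    (hone : φ 0 = 1)
    (hlim : Tendsto (fun t : ℝ => ∫ x, φ (t • x) ∂μ) (𝓝[≠] 0) (𝓝 1)) :
    IsProbabilityMeasure μ := by
  have hfin : μ Set.univ ≤ 1 := by
    have hcont (t : ℝ) : Continuous fun x : E => φ (t • x) := by fun_prop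
    calc μ Set.univ = ∫⁻ x, liminf (fun t : ℝ => ENNReal.ofReal (φ (t • x))) (𝓝[≠] 0) ∂μ := by
          rw [← lintegral_one]
          refine lintegral_congr fun x => (Tendsto.liminf_eq ?_).symm
          have : Continuous fun t : ℝ => ENNReal.ofReal (φ (t • x)) :=
            ENNReal.continuous_ofReal.comp (by fun_prop)
          simpa [hone] using (this.tendsto 0).mono_left nhdsWithin_le_nhds
      _ ≤ liminf (fun t : ℝ => ∫⁻ x, ENNReal.ofReal (φ (t • x)) ∂μ) (𝓝[≠] 0) :=
          lintegral_liminf_le' fun t => (hcont t).measurable.ennreal_ofReal.aemeasurable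
      _ = 1 := Tendsto.liminf_eq ?_
    rw [← ENNReal.ofReal_one]
    refine (ENNReal.tendsto_ofReal hlim).congr' ?_
    filter_upwards [self_mem_nhdsWithin] with t ht
    exact ofReal_integral_eq_lintegral_ofReal ((hcont t).integrable_of_hasCompactSupport
      (hc.comp_homeomorph (Homeomorph.smulOfNeZero t ht))) (.of_forall fun x => hnonneg _)
  have : IsFiniteMeasure μ := ⟨hfin.trans_lt ENNReal.one_lt_top⟩
  have h := tendsto_integral_mul_comp_smul (integrable_const (1 : ℝ)) hφ hc (μ := μ)
  simp only [one_mul, hone, mul_one, integral_const, smul_eq_mul] at h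
  have := tendsto_nhds_unique h hlim
  exact isProbabilityMeasure_iff_real.2 this

lemma laplacian_comp_smul {φ : ℂ → ℝ} (hφ : ContDiff ℝ ∞ φ) (t : ℝ) (z : ℂ) :
    (Δ fun x => φ (t • x)) z = t ^ 2 * (Δ φ) (t • z) := by
  have h := laplacian_comp_of_analyticAt (z := z) (h := fun x => (t : ℂ) * x)
    (contDiff_infty.1 hφ 2).contDiffAt (by fun_prop)
  simpa [Function.comp_def, deriv_const_mul_field] using h

lemma integral_laplacian {φ : ℂ → ℝ} (hφ : ContDiff ℝ ∞ φ) (hc : HasCompactSupport φ) :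
    ∫ z, (Δ φ) z = 0 := by
  simpa using integral_mul_laplacian (contDiff_const (c := (1 : ℝ))) hφ hc

lemma tendsto_log_norm_sub_smoothLog :
    Tendsto (fun z => Real.log ‖z‖ - smoothLog z) (cocompact ℂ) (𝓝 0) := by
  have hinv : Tendsto (fun z : ℂ => ‖z‖⁻¹ ^ 2 + 1) (cocompact ℂ) (𝓝 1) := by
    simpa using ((tendsto_inv_atTop_zero.comp (tendsto_norm_cocompact_atTop (E := ℂ))).pow
      2).add_const 1
  have hlog := ((Real.continuousAt_log one_ne_zero).tendsto.comp hinv).const_mul (-1 / 2)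
  rw [Real.log_one, mul_zero] at hlog
  refine hlog.congr' ?_
  filter_upwards [tendsto_norm_cocompact_atTop.eventually_gt_atTop 0] with z hz
  have hfactor : 1 + ‖z‖ ^ 2 = ‖z‖ ^ 2 * (‖z‖⁻¹ ^ 2 + 1) := by field_simp
  rw [smoothLog_eq_log_norm, hfactor, Real.log_mul (by positivity) (by positivity), Real.log_pow]
  simp only [Function.comp_apply]
  push_cast
  ring

lemma tendsto_integral_mul_laplacian_comp_smul {u φ : ℂ → ℝ} {a : ℝ} (hu : Continuous u)
    (hlim : Tendsto (fun z => u z - smoothLog z) (cocompact ℂ) (𝓝 a))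
    (hφ : ContDiff ℝ ∞ φ) (hc : HasCompactSupport φ) :
    Tendsto (fun t : ℝ => ∫ z, u z * (Δ fun x => φ (t • x)) z) (𝓝[≠] 0) (𝓝 (2 * π * φ 0)) := by
  set v := fun z => u z - smoothLog z
  have hv : Continuous v := hu.sub contDiff_smoothLog.continuous
  have hsmooth := tendsto_integral_mul_comp_smul integrable_laplacian_smoothLog hφ.continuous hc
  have hbdd := tendsto_integral_comp_inv_smul_mul (μ := volume) hv hlim
    ((continuous_laplacian hφ).integrable_of_hasCompactSupport (hasCompactSupport_laplacian hφ hc))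
  rw [integral_laplacian_smoothLog] at hsmooth
  rw [integral_laplacian hφ hc, mul_zero] at hbdd
  rw [← add_zero (2 * π * φ 0)]
  refine (hsmooth.add hbdd).congr' ?_
  filter_upwards [self_mem_nhdsWithin] with t (ht : t ≠ 0)
  have hφt : ContDiff ℝ ∞ fun x => φ (t • x) := hφ.comp (contDiff_const_smul t)
  have hct : HasCompactSupport fun x => φ (t • x) :=
    hc.comp_homeomorph (Homeomorph.smulOfNeZero t ht)
  have hdilate : ∫ z, v (t⁻¹ • z) * (Δ φ) z = ∫ z, v z * (Δ fun x => φ (t • x)) z := by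
    have h := Measure.integral_comp_smul volume (fun z => v (t⁻¹ • z) * (Δ φ) z) t
    rw [Complex.finrank_real_complex, abs_of_nonneg (by positivity), smul_eq_mul,
      eq_inv_mul_iff_mul_eq₀ (by positivity), ← integral_const_mul] at h
    simp only [inv_smul_smul₀ ht] at h
    rw [← h]
    simp only [laplacian_comp_smul hφ, mul_left_comm]
  rw [hdilate, ← integral_mul_laplacian contDiff_smoothLog hφt hct,
    ← integral_add (integrable_mul_laplacian contDiff_smoothLog.continuous hφt hct)
      (integrable_mul_laplacian hv hφt hct)]
  simp only [← add_mul, v, add_sub_cancel]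

end QuadraticEnergy

namespace IsDistribLaplacian

open QuadraticEnergy Laplacian

variable {u : ℂ → ℝ} {μ : Measure ℂ}

lemma measurePreserving (hμ : IsDistribLaplacian u μ) {h : ℂ → ℂ} (hh : ContDiff ℝ ∞ h)
    (hproper : IsProperMap h)
    (hu : ∀ φ : ℂ → ℝ, ContDiff ℝ ∞ φ → HasCompactSupport φ →
      ∫ z, u z * (Δ (φ ∘ h)) z = ∫ z, u z * (Δ φ) z) :
    MeasurePreserving h μ μ := by
  have := hμ.isLocallyFinite
  have hm : Measurable h := hproper.continuous.measurable
  refine ⟨hm, isDistribLaplacian_unique (u := u) ⟨?_, fun φ hφ hc => ?_⟩ hμ⟩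
  · have : IsFiniteMeasureOnCompacts (μ.map h) := ⟨fun K hK => by
      rw [Measure.map_apply hm hK.measurableSet]
      exact (hproper.isCompact_preimage hK).measure_lt_top⟩
    exact isLocallyFiniteMeasure_of_isFiniteMeasureOnCompacts
  · rw [integral_map hm.aemeasurable hφ.continuous.aestronglyMeasurable, ← hu φ hφ hc]
    exact hμ.integral_eq _ (hφ.comp hh) (hasCompactSupport_comp_of_isProperMap hc hproper)

lemma isProbabilityMeasure (hμ : IsDistribLaplacian u μ) (hu : Continuous u) {a : ℝ}
    (hlim : Tendsto (fun z => u z - Real.log ‖z‖) (cocompact ℂ) (𝓝 a)) :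
    IsProbabilityMeasure μ := by
  have := hμ.isLocallyFinite
  let φ : ContDiffBump (0 : ℂ) := default
  have hlim' : Tendsto (fun z => u z - smoothLog z) (cocompact ℂ) (𝓝 a) := by
    simpa using hlim.add tendsto_log_norm_sub_smoothLog
  refine isProbabilityMeasure_of_tendsto_integral_comp_smul φ.continuous φ.hasCompactSupport
    (fun _ => φ.nonneg) (φ.one_of_mem_closedBall (by simp [φ.rIn_pos.le])) ?_
  have h := (tendsto_integral_mul_laplacian_comp_smul hu hlim' φ.contDiff
    φ.hasCompactSupport).const_mul (1 / (2 * π))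
  rw [φ.one_of_mem_closedBall (by simp [φ.rIn_pos.le]), mul_one,
    one_div_mul_cancel (by positivity)] at h
  refine h.congr' ?_
  filter_upwards [self_mem_nhdsWithin] with t (ht : t ≠ 0)
  exact (hμ.integral_eq _ (φ.contDiff.comp (contDiff_const_smul t))
    (φ.hasCompactSupport.comp_homeomorph (Homeomorph.smulOfNeZero t ht))).symm

end IsDistribLaplacian

namespace QuadraticEnergy

open Laplacian

/-! ### Growth of the escape rate -/

lemma le_escapeRate {c z : ℂ} {B : ℝ} (hB : 0 < B)
    (h : ∀ n : ℕ, B ^ 2 ^ n ≤ ‖(quadraticMap c)^[n] z‖) : Real.log B ≤ escapeRate c z := by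
  refine ge_of_tendsto' (tendsto_escapeRate c z) fun n => ?_
  rw [one_div, ← div_eq_inv_mul, le_div_iff₀' (by positivity)]
  calc 2 ^ n * Real.log B = Real.log (B ^ 2 ^ n) := by
        rw [Real.log_pow]
        push_cast
        rfl
    _ ≤ Real.log ‖(quadraticMap c)^[n] z‖ := Real.log_le_log (by positivity) (h n)
    _ ≤ Real.posLog ‖(quadraticMap c)^[n] z‖ := le_max_right _ _

lemma escapeRate_le {c z : ℂ} {B : ℝ} (hB : 1 ≤ B)
    (h : ∀ n : ℕ, ‖(quadraticMap c)^[n] z‖ ≤ B ^ 2 ^ n) : escapeRate c z ≤ Real.log B := by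
  refine le_of_tendsto' (tendsto_escapeRate c z) fun n => ?_
  rw [one_div, ← div_eq_inv_mul, div_le_iff₀' (by positivity)]
  calc Real.posLog ‖(quadraticMap c)^[n] z‖ ≤ Real.posLog (B ^ 2 ^ n) :=
        Real.posLog_le_posLog (norm_nonneg _) (h n)
    _ = Real.log (B ^ 2 ^ n) := Real.posLog_eq_log ((one_le_pow₀ hB).trans (le_abs_self _))
    _ = 2 ^ n * Real.log B := by
        rw [Real.log_pow]
        push_cast
        rfl

lemma escapeRate_nonneg (c z : ℂ) : 0 ≤ escapeRate c z :=
  ge_of_tendsto' (tendsto_escapeRate c z) fun _ => mul_nonneg (by positivity) Real.posLog_nonneg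

lemma escapeRate_quadraticMap (c z : ℂ) :
    escapeRate c (quadraticMap c z) = 2 * escapeRate c z := by
  refine tendsto_nhds_unique (tendsto_escapeRate c (quadraticMap c z)) ?_
  refine (((tendsto_escapeRate c z).comp (tendsto_add_atTop_nat 1)).const_mul 2).congr fun n => ?_
  simp only [Function.comp_apply, Function.iterate_succ_apply, pow_succ]
  field_simp

lemma quadraticMap_neg (c z : ℂ) : quadraticMap c (-z) = quadraticMap c z := by
  simp only [quadraticMap, neg_sq]

lemma escapeRate_neg (c z : ℂ) : escapeRate c (-z) = escapeRate c z := by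
  have h := escapeRate_quadraticMap c (-z)
  rw [quadraticMap_neg, escapeRate_quadraticMap] at h
  linarith

lemma norm_quadraticMap_le (c z : ℂ) : ‖quadraticMap c z‖ ≤ ‖z‖ ^ 2 + ‖c‖ :=
  (norm_add_le (z ^ 2) c).trans_eq (by rw [norm_pow])

lemma le_norm_quadraticMap (c z : ℂ) : ‖z‖ ^ 2 - ‖c‖ ≤ ‖quadraticMap c z‖ :=
  (norm_sub_le_norm_add (z ^ 2) c).trans_eq' (by rw [norm_pow])

lemma pow_le_mul_norm_iterate {c z : ℂ} {a : ℝ} (ha : 0 < a) (haz : 1 ≤ a * ‖z‖)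
    (hc : ‖c‖ ≤ (1 - a) * ‖z‖ ^ 2) (n : ℕ) :
    (a * ‖z‖) ^ 2 ^ n ≤ a * ‖(quadraticMap c)^[n] z‖ := by
  have ha1 : 0 ≤ 1 - a := by
    have hz : 0 < ‖z‖ := pos_of_mul_pos_right (one_pos.trans_le haz) ha.le
    exact nonneg_of_mul_nonneg_left ((norm_nonneg c).trans hc) (by positivity)
  induction n with
  | zero => simp
  | succ n ih =>
    rw [Function.iterate_succ_apply']
    set w := (quadraticMap c)^[n] z
    have hzw : ‖z‖ ≤ ‖w‖ := by
      refine le_of_mul_le_mul_left (le_trans ?_ ih) ha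
      exact le_self_pow₀ haz (by positivity)
    have hcw : ‖c‖ ≤ (1 - a) * ‖w‖ ^ 2 := hc.trans (by gcongr)
    calc (a * ‖z‖) ^ 2 ^ (n + 1) = ((a * ‖z‖) ^ 2 ^ n) ^ 2 := by ring
      _ ≤ (a * ‖w‖) ^ 2 := by gcongr
      _ = a * (a * ‖w‖ ^ 2) := by ring
      _ ≤ a * (‖w‖ ^ 2 - ‖c‖) := by
          gcongr
          linarith
      _ ≤ a * ‖quadraticMap c w‖ := by
          gcongr
          exact le_norm_quadraticMap c w

lemma mul_norm_iterate_le_pow {c z : ℂ} {b T : ℝ} (hb : 1 ≤ b) (hT : 1 ≤ T) (hz : ‖z‖ ≤ T)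
    (hc : ‖c‖ ≤ (b - 1) * T ^ 2) (n : ℕ) :
    b * ‖(quadraticMap c)^[n] z‖ ≤ (b * T) ^ 2 ^ n := by
  have hbT : 1 ≤ b * T := one_le_mul_of_one_le_of_one_le hb hT
  induction n with
  | zero =>
    rw [Function.iterate_zero_apply, pow_zero, pow_one]
    gcongr
  | succ n ih =>
    rw [Function.iterate_succ_apply']
    set w := (quadraticMap c)^[n] z
    set S := (b * T) ^ 2 ^ n
    have hTS : b * T ≤ S := le_self_pow₀ hbT (by positivity)
    refine le_of_mul_le_mul_left (a := b) ?_ (by positivity)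
    calc b * (b * ‖quadraticMap c w‖) ≤ b * (b * (‖w‖ ^ 2 + (b - 1) * T ^ 2)) := by
          gcongr
          exact (norm_quadraticMap_le c w).trans (by gcongr)
      _ = (b * ‖w‖) ^ 2 + (b - 1) * (b * T) ^ 2 := by ring
      _ ≤ S ^ 2 + (b - 1) * S ^ 2 := by
          have := sub_nonneg.2 hb
          gcongr
      _ = b * (b * T) ^ 2 ^ (n + 1) := by
          simp only [S]
          ring

lemma log_norm_sub_div_le_escapeRate {c z : ℂ} (hc : ‖c‖ ≤ ‖z‖ ^ 2) :
    Real.log (‖z‖ - ‖c‖ / ‖z‖) ≤ escapeRate c z := by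
  obtain rfl | hz := eq_or_ne z 0
  · simpa using escapeRate_nonneg c 0
  have hz : 0 < ‖z‖ := norm_pos_iff.2 hz
  set a := 1 - ‖c‖ / ‖z‖ ^ 2 with ha
  have ha0 : 0 ≤ a := sub_nonneg.2 ((div_le_one (by positivity)).2 hc)
  have ha1 : a ≤ 1 := sub_le_self _ (by positivity)
  have haz : ‖z‖ - ‖c‖ / ‖z‖ = a * ‖z‖ := by
    rw [ha]
    field_simp
  rw [haz]
  obtain h1 | h1 := le_total (a * ‖z‖) 1
  · exact (Real.log_nonpos (by positivity) h1).trans (escapeRate_nonneg c z)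
  have ha0 : 0 < a := pos_of_mul_pos_left (one_pos.trans_le h1) hz.le
  refine le_escapeRate (by positivity) fun n =>
    (pow_le_mul_norm_iterate ha0 h1 (le_of_eq ?_) n).trans
      (mul_le_of_le_one_left (by positivity) ha1)
  rw [ha]
  field_simp
  ring

lemma escapeRate_le_log_add_div {c z : ℂ} {T : ℝ} (hT : 1 ≤ T) (hz : ‖z‖ ≤ T) :
    escapeRate c z ≤ Real.log (T + ‖c‖ / T) := by
  set b := 1 + ‖c‖ / T ^ 2 with hb
  have hb1 : 1 ≤ b := le_add_of_nonneg_right (by positivity)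
  have hbT : T + ‖c‖ / T = b * T := by
    rw [hb]
    field_simp
  rw [hbT]
  refine escapeRate_le (one_le_mul_of_one_le_of_one_le hb1 hT) fun n =>
    (le_mul_of_one_le_left (by positivity) hb1).trans
      (mul_norm_iterate_le_pow hb1 hT hz (le_of_eq ?_) n)
  rw [hb]
  field_simp
  ring

lemma tendsto_escapeRate_sub_log (c : ℂ) :
    Tendsto (fun z => escapeRate c z - Real.log ‖z‖) (cocompact ℂ) (𝓝 0) := by
  have hnorm : Tendsto (norm : ℂ → ℝ) (cocompact ℂ) atTop := tendsto_norm_cocompact_atTop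
  have hratio : Tendsto (fun z : ℂ => ‖c‖ / ‖z‖ ^ 2) (cocompact ℂ) (𝓝 0) :=
    tendsto_const_nhds.div_atTop ((tendsto_pow_atTop two_ne_zero).comp hnorm)
  have hlog : Tendsto Real.log (𝓝 1) (𝓝 0) := by
    simpa using (Real.continuousAt_log one_ne_zero).tendsto
  have hlower : Tendsto (fun z : ℂ => Real.log (1 - ‖c‖ / ‖z‖ ^ 2)) (cocompact ℂ) (𝓝 0) :=
    hlog.comp (by simpa using hratio.const_sub 1)
  have hupper : Tendsto (fun z : ℂ => Real.log (1 + ‖c‖ / ‖z‖ ^ 2)) (cocompact ℂ) (𝓝 0) :=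
    hlog.comp (by simpa using hratio.const_add 1)
  refine tendsto_of_tendsto_of_tendsto_of_le_of_le' hlower hupper ?_ ?_
  · filter_upwards [hnorm.eventually_gt_atTop 0, hratio.eventually_lt_const one_pos] with z hz hcz
    have hfactor : ‖z‖ - ‖c‖ / ‖z‖ = ‖z‖ * (1 - ‖c‖ / ‖z‖ ^ 2) := by field_simp
    have h := log_norm_sub_div_le_escapeRate ((div_le_one (by positivity)).1 hcz.le)
    rw [hfactor, Real.log_mul hz.ne' (sub_pos.2 hcz).ne'] at h
    linarith
  · filter_upwards [hnorm.eventually_ge_atTop 1] with z hz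
    have hfactor : ‖z‖ + ‖c‖ / ‖z‖ = ‖z‖ * (1 + ‖c‖ / ‖z‖ ^ 2) := by field_simp
    have h := escapeRate_le_log_add_div (c := c) hz le_rfl
    rw [hfactor, Real.log_mul (by positivity) (by positivity)] at h
    linarith

/-! ### The equilibrium measure -/

lemma contDiff_quadraticMap (c : ℂ) : ContDiff ℂ ∞ (quadraticMap c) := by
  unfold quadraticMap
  fun_prop

lemma isProperMap_quadraticMap (c : ℂ) : IsProperMap (quadraticMap c) := by
  open Polynomial in
  have h := isProperMap_eval (X ^ 2 + C c : ℂ[X]) (by rw [degree_X_pow_add_C two_pos]; simp)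
  convert h using 1
  funext z
  simp [quadraticMap]

lemma isDistribLaplacian_equilibriumMeasure (c : ℂ) :
    IsDistribLaplacian (escapeRate c) (equilibriumMeasure c) :=
  (existsUnique_equilibriumMeasure c).choose_spec.1

instance isProbabilityMeasure_equilibriumMeasure (c : ℂ) :
    IsProbabilityMeasure (equilibriumMeasure c) :=
  (isDistribLaplacian_equilibriumMeasure c).isProbabilityMeasure (continuous_escapeRate c)
    (tendsto_escapeRate_sub_log c)

lemma integral_escapeRate_mul_laplacian_comp_quadraticMap (c : ℂ) {φ : ℂ → ℝ}
    (hφ : ContDiff ℝ ∞ φ) (hc : HasCompactSupport φ) :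
    ∫ z, escapeRate c z * (Δ (φ ∘ quadraticMap c)) z = ∫ z, escapeRate c z * (Δ φ) z := by
  set G : ℂ → ℝ := fun w => escapeRate c (w + c) * (Δ φ) (w + c)
  have hpull (z : ℂ) : ‖2 * z‖ ^ 2 • G (z ^ 2) =
      2 * (escapeRate c z * (Δ (φ ∘ quadraticMap c)) z) := by
    have hderiv : deriv (quadraticMap c) z = 2 * z := by
      unfold quadraticMap
      simp
    rw [laplacian_comp_of_analyticAt (contDiff_infty.1 hφ 2).contDiffAt
      (by unfold quadraticMap; fun_prop), hderiv]
    change ‖2 * z‖ ^ 2 • (escapeRate c (quadraticMap c z) * (Δ φ) (quadraticMap c z)) = _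
    rw [escapeRate_quadraticMap, smul_eq_mul, smul_eq_mul]
    ring
  have hcomp : Integrable fun z => escapeRate c z * (Δ (φ ∘ quadraticMap c)) z :=
    integrable_mul_laplacian (continuous_escapeRate c)
      (hφ.comp ((contDiff_quadraticMap c).restrict_scalars ℝ))
      (hasCompactSupport_comp_of_isProperMap hc (isProperMap_quadraticMap c))
  have hsq := integral_comp_sq (F := G)
    ((hcomp.const_mul 2).congr (.of_forall fun z => (hpull z).symm))
  have htrans : ∫ w, G w = ∫ w, escapeRate c w * (Δ φ) w :=
    integral_add_right_eq_self (fun w => escapeRate c w * (Δ φ) w) c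
  simp only [hpull, integral_const_mul, htrans, smul_eq_mul] at hsq
  exact mul_left_cancel₀ two_ne_zero hsq

lemma measurePreserving_quadraticMap (c : ℂ) :
    MeasurePreserving (quadraticMap c) (equilibriumMeasure c) (equilibriumMeasure c) :=
  (isDistribLaplacian_equilibriumMeasure c).measurePreserving
    ((contDiff_quadraticMap c).restrict_scalars ℝ) (isProperMap_quadraticMap c)
    fun _ => integral_escapeRate_mul_laplacian_comp_quadraticMap c

lemma measurePreserving_neg (c : ℂ) :
    MeasurePreserving (fun z => -z) (equilibriumMeasure c) (equilibriumMeasure c) := by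
  refine (isDistribLaplacian_equilibriumMeasure c).measurePreserving contDiff_neg
    (Homeomorph.neg ℂ).isProperMap fun φ hφ _ => ?_
  have hpull (z : ℂ) : escapeRate c z * (Δ (φ ∘ fun z => -z)) z =
      escapeRate c (-z) * (Δ φ) (-z) := by
    rw [laplacian_comp_of_analyticAt (contDiff_infty.1 hφ 2).contDiffAt (by fun_prop),
      escapeRate_neg]
    simp
  simp only [hpull]
  exact integral_neg_eq_self (fun z => escapeRate c z * (Δ φ) z) volume

lemma ae_not_tendsto_atTop_iterate {X : Type*} [MeasurableSpace X] {μ : Measure X} {f : X → X}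
    (hf : Conservative f μ) {N : X → ℝ} (hN : Measurable N) :
    ∀ᵐ x ∂μ, ¬ Tendsto (fun n => N (f^[n] x)) atTop atTop := by
  have hrec := ae_all_iff.2 fun k : ℕ =>
    hf.ae_mem_imp_frequently_image_mem (measurableSet_lt hN measurable_const).nullMeasurableSet
      (s := {x | N x < k})
  filter_upwards [hrec] with x hx htop
  obtain ⟨k, hk⟩ := exists_nat_gt (N x)
  obtain ⟨n, hn, hkn⟩ := ((hx k hk).and_eventually (htop.eventually_ge_atTop k)).exists
  exact hkn.not_gt hn

lemma escapeRate_iterate (c z : ℂ) (n : ℕ) :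
    escapeRate c ((quadraticMap c)^[n] z) = 2 ^ n * escapeRate c z := by
  induction n with
  | zero => simp
  | succ n ih => rw [Function.iterate_succ_apply', escapeRate_quadraticMap, ih, pow_succ']; ring

/-- The filled Julia set of `f_c`, encoded as the zero set of the escape rate instead of the set of
points with bounded orbit. -/
def filledJuliaSet (c : ℂ) : Set ℂ := {z | escapeRate c z = 0}

lemma quadraticMap_mem_filledJuliaSet {c z : ℂ} (hz : z ∈ filledJuliaSet c) :
    quadraticMap c z ∈ filledJuliaSet c := by
  simp_all [filledJuliaSet, escapeRate_quadraticMap]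

lemma ae_mem_filledJuliaSet (c : ℂ) : ∀ᵐ z ∂equilibriumMeasure c, z ∈ filledJuliaSet c := by
  filter_upwards [ae_not_tendsto_atTop_iterate (measurePreserving_quadraticMap c).conservative
    (continuous_escapeRate c).measurable] with z hz
  by_contra hne
  refine hz ?_
  simp only [escapeRate_iterate]
  exact (tendsto_pow_atTop_atTop_of_one_lt one_lt_two).atTop_mul_const
    ((escapeRate_nonneg c z).lt_of_ne' hne)

lemma norm_le_of_mem_filledJuliaSet {c z : ℂ} {ρ : ℝ} (hρ : 1 ≤ ρ) (hc : ‖c‖ ≤ ρ * (ρ - 1))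
    (hz : z ∈ filledJuliaSet c) : ‖z‖ ≤ ρ := by
  by_contra! hlt
  have hz0 : 0 < ‖z‖ := by linarith
  have hgt : ‖c‖ < ‖z‖ * (‖z‖ - 1) := hc.trans_lt (by gcongr)
  have hone : 1 < ‖z‖ - ‖c‖ / ‖z‖ := by
    have : ‖c‖ / ‖z‖ < ‖z‖ - 1 := (div_lt_iff₀' hz0).2 hgt
    linarith
  have h := log_norm_sub_div_le_escapeRate (c := c) (z := z) (by nlinarith)
  exact (Real.log_pos hone).not_ge (h.trans_eq hz)

lemma integrable_equilibriumMeasure {g : ℂ → ℝ} (hg : Continuous g) (c : ℂ) :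
    Integrable g (equilibriumMeasure c) := by
  obtain ⟨C, hC⟩ := (isCompact_closedBall (0 : ℂ) (‖c‖ + 1)).exists_bound_of_continuousOn
    hg.continuousOn
  refine .of_bound hg.aestronglyMeasurable C ?_
  filter_upwards [ae_mem_filledJuliaSet c] with z hz
  refine hC z (mem_closedBall_zero_iff.2 (norm_le_of_mem_filledJuliaSet ?_ ?_ hz)) <;>
    nlinarith [norm_nonneg c]

/-! ### Energy estimates -/

variable {c₁ c₂ : ℂ}

lemma integral_comp_of_measurePreserving {X Y E : Type*} [MeasurableSpace X] [MeasurableSpace Y]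
    [NormedAddCommGroup E] [NormedSpace ℝ E] {μ : Measure X} {ν : Measure Y} {f : X → Y}
    (hf : MeasurePreserving f μ ν) {g : Y → E} (hg : AEStronglyMeasurable g ν) :
    ∫ x, g (f x) ∂μ = ∫ y, g y ∂ν := by
  rw [← hf.map_eq] at hg ⊢
  exact (integral_map hf.aemeasurable hg).symm

lemma le_integral_equilibriumMeasure {g : ℂ → ℝ} (hg : Continuous g) {c : ℂ} {a : ℝ}
    (h : ∀ z ∈ filledJuliaSet c, a ≤ g z) : a ≤ ∫ z, g z ∂equilibriumMeasure c := by
  have := integral_mono_ae (integrable_const a) (integrable_equilibriumMeasure hg c)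
    ((ae_mem_filledJuliaSet c).mono h)
  simpa using this

lemma integral_equilibriumMeasure_le {g : ℂ → ℝ} (hg : Continuous g) {c : ℂ} {a : ℝ}
    (h : ∀ z ∈ filledJuliaSet c, g z ≤ a) : ∫ z, g z ∂equilibriumMeasure c ≤ a := by
  have := integral_mono_ae (integrable_equilibriumMeasure hg c) (integrable_const a)
    ((ae_mem_filledJuliaSet c).mono h)
  simpa using this

lemma archimedeanEnergy_nonneg (c₁ c₂ : ℂ) : 0 ≤ archimedeanEnergy c₁ c₂ :=
  integral_nonneg (escapeRate_nonneg c₁)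

lemma archimedeanEnergy_eq_integral_add (c₁ c₂ : ℂ) : archimedeanEnergy c₁ c₂ =
    1 / 2 * ∫ y, escapeRate c₁ (y + (c₁ - c₂)) ∂equilibriumMeasure c₂ := by
  have hcont : Continuous fun y => escapeRate c₁ (y + (c₁ - c₂)) :=
    (continuous_escapeRate c₁).comp (by fun_prop)
  rw [← integral_comp_of_measurePreserving (measurePreserving_quadraticMap c₂)
    hcont.aestronglyMeasurable, ← integral_const_mul, archimedeanEnergy]
  refine integral_congr_ae (.of_forall fun z => ?_)
  have hshift : quadraticMap c₂ z + (c₁ - c₂) = quadraticMap c₁ z := by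
    simp only [quadraticMap]
    ring
  simp only [hshift, escapeRate_quadraticMap]
  ring

lemma archimedeanEnergy_eq_integral_add_add_integral_neg_add (c₁ c₂ : ℂ) :
    archimedeanEnergy c₁ c₂ = 1 / 4 * ∫ y, (escapeRate c₁ (y + (c₁ - c₂)) +
      escapeRate c₁ (-y + (c₁ - c₂))) ∂equilibriumMeasure c₂ := by
  have hcont : Continuous fun y => escapeRate c₁ (y + (c₁ - c₂)) :=
    (continuous_escapeRate c₁).comp (by fun_prop)
  have hneg := integral_comp_of_measurePreserving (measurePreserving_neg c₂)
    hcont.aestronglyMeasurable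
  have hadd := integral_add (integrable_equilibriumMeasure hcont c₂)
    (integrable_equilibriumMeasure (hcont.comp continuous_neg) c₂)
  simp only [Function.comp_apply, hneg] at hadd
  rw [hadd, archimedeanEnergy_eq_integral_add]
  ring

lemma archimedeanEnergy_le_log {M : ℝ} (hM : 1 ≤ M) (h₁ : ‖c₁‖ ≤ M ^ 2) (h₂ : ‖c₂‖ ≤ M ^ 2) :
    archimedeanEnergy c₁ c₂ ≤ Real.log M + Real.log 3 := by
  rw [← Real.log_mul (by positivity) (by positivity)]
  refine integral_equilibriumMeasure_le (continuous_escapeRate c₁) fun z hz => ?_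
  have hzM : ‖z‖ ≤ M + 1 := norm_le_of_mem_filledJuliaSet (by linarith) (by nlinarith) hz
  have hcM : ‖c₁‖ / (M + 1) ≤ M := (div_le_iff₀ (by positivity)).2 (by nlinarith)
  refine (escapeRate_le_log_add_div (by linarith) hzM).trans (Real.log_le_log (by positivity) ?_)
  linarith

lemma log_le_escapeRate {c w : ℂ} {s : ℝ} (hs : 0 < s) (hc : ‖c‖ ≤ s ^ 2) (hw : 2 * s ≤ ‖w‖) :
    Real.log s ≤ escapeRate c w := by
  have hdiv : ‖c‖ / ‖w‖ ≤ s := (div_le_iff₀ (by linarith)).2 (by nlinarith)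
  exact (Real.log_le_log hs (by linarith)).trans
    (log_norm_sub_div_le_escapeRate (by nlinarith))

lemma half_log_le_archimedeanEnergy {s : ℝ} (hs : 0 < s) (h₁ : ‖c₁‖ ≤ s ^ 2) (h₂ : ‖c₂‖ ≤ s ^ 2)
    (hfar : 3 * s + 1 ≤ ‖c₁ - c₂‖) : 1 / 2 * Real.log s ≤ archimedeanEnergy c₁ c₂ := by
  rw [archimedeanEnergy_eq_integral_add]
  gcongr
  refine le_integral_equilibriumMeasure ((continuous_escapeRate c₁).comp (by fun_prop))
    fun y hy => log_le_escapeRate hs h₁ ?_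
  have hys : ‖y‖ ≤ s + 1 := norm_le_of_mem_filledJuliaSet (by linarith) (by nlinarith) hy
  calc 2 * s ≤ ‖c₁ - c₂‖ - ‖y‖ := by linarith
    _ ≤ ‖y + (c₁ - c₂)‖ := (norm_sub_le_norm_add _ _).trans_eq (by rw [add_comm])

lemma norm_sub_le_or_norm_add_le {c p q : ℂ} {ε : ℝ} (hq : q ^ 2 = -c) (hq0 : q ≠ 0)
    (h : ‖quadraticMap c p‖ ≤ ε * ‖q‖) : ‖p - q‖ ≤ ε ∨ ‖p + q‖ ≤ ε := by
  by_contra! hlt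
  obtain ⟨hsub, hadd⟩ := hlt
  have hq0 : 0 < ‖q‖ := norm_pos_iff.2 hq0
  have hfactor : quadraticMap c p = (p - q) * (p + q) := by
    rw [quadraticMap, ← neg_neg c, ← hq]
    ring
  have hsum : 2 * ‖q‖ ≤ ‖p - q‖ + ‖p + q‖ := by
    calc 2 * ‖q‖ = ‖(p + q) - (p - q)‖ := by
          rw [show (p + q) - (p - q) = 2 * q by ring, norm_mul, Complex.norm_two]
      _ ≤ ‖p - q‖ + ‖p + q‖ := (norm_sub_le _ _).trans_eq (add_comm _ _)
  rw [hfactor, norm_mul] at h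
  obtain hle | hle : ‖q‖ ≤ ‖p - q‖ ∨ ‖q‖ ≤ ‖p + q‖ := by
    by_contra! hlt
    linarith
  · linarith [mul_lt_mul_of_pos_right hadd hq0,
      mul_le_mul_of_nonneg_right hle (norm_nonneg (p + q))]
  · linarith [mul_lt_mul_of_pos_right hsub hq0,
      mul_le_mul_of_nonneg_left hle (norm_nonneg (p - q))]

lemma norm_le_or_norm_le_of_add_sub_near {E : Type*} [NormedAddCommGroup E] [NormedSpace ℝ E]
    {A B q : E} {ε : ℝ} (hadd : ‖A + B - q‖ ≤ ε ∨ ‖A + B + q‖ ≤ ε)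
    (hsub : ‖A - B - q‖ ≤ ε ∨ ‖A - B + q‖ ≤ ε) : ‖B‖ ≤ ε ∨ ‖A‖ ≤ ε ∧ ‖B‖ ≤ ‖q‖ + ε := by
  have hhalf {x y z : E} (hx : ‖x‖ ≤ ε) (hy : ‖y‖ ≤ ε)
      (hz : (2 : ℝ) • z = x + y ∨ (2 : ℝ) • z = x - y) : ‖z‖ ≤ ε := by
    have h2 : ‖(2 : ℝ) • z‖ ≤ ‖x‖ + ‖y‖ := by
      rcases hz with hz | hz <;> rw [hz]
      · exact norm_add_le x y
      · exact norm_sub_le x y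
    rw [norm_smul, Real.norm_ofNat] at h2
    linarith
  rcases hadd with hadd | hadd <;> rcases hsub with hsub | hsub
  · exact .inl (hhalf hadd hsub (.inr (by module)))
  · refine .inr ⟨hhalf hadd hsub (.inl (by module)), ?_⟩
    have hB : ‖B - q‖ ≤ ε := hhalf hadd hsub (.inr (by module))
    linarith [norm_le_norm_add_norm_sub' B q]
  · refine .inr ⟨hhalf hadd hsub (.inl (by module)), ?_⟩
    have hB : ‖-B - q‖ ≤ ε := by
      rw [← norm_neg]
      exact hhalf hadd hsub (.inr (by module))
    linarith [norm_le_norm_add_norm_sub' (-B) q, norm_neg B]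
  · exact .inl (hhalf hadd hsub (.inr (by module)))

lemma norm_le_norm_sq_add_of_mem_filledJuliaSet {c z : ℂ} {ρ : ℝ} (hρ : 1 ≤ ρ)
    (hc : ‖c‖ ≤ ρ * (ρ - 1)) (hz : z ∈ filledJuliaSet c) : ‖c‖ ≤ ‖z‖ ^ 2 + ρ := by
  have hfz := norm_le_of_mem_filledJuliaSet hρ hc (quadraticMap_mem_filledJuliaSet hz)
  have hadd := norm_le_norm_add_norm_sub' c (quadraticMap c z)
  rw [quadraticMap, sub_add_cancel_right, norm_neg, norm_pow] at hadd
  rw [quadraticMap] at hfz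
  linarith

lemma max_norm_sub_norm_sub_le_min_norm {E : Type*} [SeminormedAddCommGroup E] (x y : E) :
    max ‖x‖ ‖y‖ - ‖x - y‖ ≤ min ‖x‖ ‖y‖ := by
  have := norm_le_norm_add_norm_sub' x y
  have := norm_le_norm_add_norm_sub x y
  have := norm_nonneg (x - y)
  grind

lemma sub_three_le_norm_of_mem_filledJuliaSet {c z : ℂ} {s : ℝ} (hs : 6 ≤ s) (hc : ‖c‖ ≤ s ^ 2)
    (hc' : s ^ 2 - (3 * s + 1) ≤ ‖c‖) (hz : z ∈ filledJuliaSet c) : s - 3 ≤ ‖z‖ := by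
  have := norm_le_norm_sq_add_of_mem_filledJuliaSet (ρ := s + 1) (by linarith) (by nlinarith) hz
  exact (abs_le_of_sq_le_sq' (by nlinarith) (norm_nonneg z)).2

lemma quadraticMap_add_sub (c₁ c₂ y : ℂ) : quadraticMap c₁ (y + (c₁ - c₂)) =
    quadraticMap c₂ y + (c₁ - c₂) + (c₁ - c₂) ^ 2 + 2 * y * (c₁ - c₂) := by
  simp only [quadraticMap]
  ring

lemma quadraticMap_neg_add_sub (c₁ c₂ y : ℂ) : quadraticMap c₁ (-y + (c₁ - c₂)) =
    quadraticMap c₂ y + (c₁ - c₂) + (c₁ - c₂) ^ 2 - 2 * y * (c₁ - c₂) := by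
  rw [quadraticMap_add_sub, quadraticMap_neg]
  ring

lemma two_mul_le_norm_or_two_mul_le_norm {s : ℝ} (hs : 10 ≤ s) (hmax : max ‖c₁‖ ‖c₂‖ = s ^ 2)
    (hnear : ‖c₁ - c₂‖ ≤ 3 * s + 1) (hsep : 3 ≤ s * ‖c₁ - c₂‖) {y : ℂ}
    (hy : y ∈ filledJuliaSet c₂) :
    2 * s ≤ ‖quadraticMap c₁ (quadraticMap c₁ (y + (c₁ - c₂)))‖ ∨
      2 * s ≤ ‖quadraticMap c₁ (quadraticMap c₁ (-y + (c₁ - c₂)))‖ := by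
  have hmin := max_norm_sub_norm_sub_le_min_norm c₁ c₂
  rw [hmax, le_min_iff] at hmin
  obtain ⟨h₁, h₂⟩ := max_le_iff.1 hmax.le
  have hlower {z : ℂ} (hz : z ∈ filledJuliaSet c₂) : s - 3 ≤ ‖z‖ :=
    sub_three_le_norm_of_mem_filledJuliaSet (by linarith) h₂ (by linarith) hz
  have hys := hlower hy
  have hus := hlower (quadraticMap_mem_filledJuliaSet hy)
  obtain ⟨q, hq⟩ := IsAlgClosed.exists_pow_nat_eq (-c₁) two_pos
  have hqc : ‖q‖ ^ 2 = ‖c₁‖ := by rw [← norm_pow, hq, norm_neg]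
  have hqs : s - 2 ≤ ‖q‖ := (abs_le_of_sq_le_sq' (by nlinarith) (norm_nonneg q)).2
  have hqs' : ‖q‖ ≤ s := (abs_le_of_sq_le_sq' (by linarith) (by linarith)).2
  have hq0 : q ≠ 0 := norm_pos_iff.1 (by linarith)
  set δ := c₁ - c₂ with hδ
  set u := quadraticMap c₂ y with hu
  by_contra! hlt
  rw [quadraticMap_add_sub, quadraticMap_neg_add_sub, ← hδ, ← hu] at hlt
  have hsmall : 2 * s ≤ 5 / 2 * ‖q‖ := by linarith
  obtain hB | ⟨hA, hB⟩ := norm_le_or_norm_le_of_add_sub_near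
    (norm_sub_le_or_norm_add_le hq hq0 (hlt.1.le.trans hsmall))
    (norm_sub_le_or_norm_add_le hq hq0 (hlt.2.le.trans hsmall))
  all_goals rw [norm_mul, norm_mul, Complex.norm_two] at hB
  · nlinarith [norm_nonneg δ]
  · have hδ1 : ‖δ‖ ≤ 1 := by nlinarith [norm_nonneg δ]
    have : ‖u‖ ≤ ‖u + δ + δ ^ 2‖ + ‖δ‖ + ‖δ‖ ^ 2 := by
      calc ‖u‖ = ‖u + δ + δ ^ 2 - δ - δ ^ 2‖ := by rw [add_sub_right_comm, add_sub_cancel_right,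
            add_sub_cancel_right]
        _ ≤ ‖u + δ + δ ^ 2‖ + ‖δ‖ + ‖δ‖ ^ 2 := by
          rw [← norm_pow]
          exact (norm_sub_le _ _).trans (by gcongr; exact norm_sub_le _ _)
    nlinarith [norm_nonneg δ]

lemma sixteenth_log_le_archimedeanEnergy {s : ℝ} (hs : 10 ≤ s)
    (hmax : max ‖c₁‖ ‖c₂‖ = s ^ 2) (hnear : ‖c₁ - c₂‖ ≤ 3 * s + 1)
    (hsep : 3 ≤ s * ‖c₁ - c₂‖) : 1 / 16 * Real.log s ≤ archimedeanEnergy c₁ c₂ := by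
  have h₁ : ‖c₁‖ ≤ s ^ 2 := (le_max_left _ _).trans_eq hmax
  have hescape {w : ℂ} (hw : 2 * s ≤ ‖quadraticMap c₁ (quadraticMap c₁ w)‖) :
      1 / 4 * Real.log s ≤ escapeRate c₁ w := by
    have h := log_le_escapeRate (by linarith) h₁ hw
    rw [escapeRate_quadraticMap, escapeRate_quadraticMap] at h
    linarith
  have hcont := continuous_escapeRate c₁
  have hmean : 1 / 4 * Real.log s ≤ ∫ y, (escapeRate c₁ (y + (c₁ - c₂)) +
      escapeRate c₁ (-y + (c₁ - c₂))) ∂equilibriumMeasure c₂ := by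
    refine le_integral_equilibriumMeasure (by fun_prop) fun y hy => ?_
    rcases two_mul_le_norm_or_two_mul_le_norm hs hmax hnear hsep hy with h | h
    · linarith [hescape h, escapeRate_nonneg c₁ (-y + (c₁ - c₂))]
    · linarith [hescape h, escapeRate_nonneg c₁ (y + (c₁ - c₂))]
  rw [archimedeanEnergy_eq_integral_add_add_integral_neg_add]
  linarith

lemma archimedeanEnergy_le (c₁ c₂ : ℂ) :
    archimedeanEnergy c₁ c₂ ≤ 1 / 2 * Real.posLog (max ‖c₁‖ ‖c₂‖) + Real.log 3 := by
  set m := max ‖c₁‖ ‖c₂‖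
  have hm : 0 ≤ m := (norm_nonneg c₁).trans (le_max_left _ _)
  have hlog : Real.log √(max 1 m) = 1 / 2 * Real.posLog m := by
    rw [Real.log_sqrt (by positivity), Real.posLog_eq_log_max_one hm]
    ring
  have hsq : √(max 1 m) ^ 2 = max 1 m := Real.sq_sqrt (by positivity)
  rw [← hlog]
  refine archimedeanEnergy_le_log (Real.one_le_sqrt.2 (le_max_left _ _)) ?_ ?_ <;> rw [hsq]
  · exact (le_max_left _ _).trans (le_max_right _ _)
  · exact (le_max_right _ _).trans (le_max_right _ _)

lemma posLog_le_log {x y : ℝ} (hx : 0 ≤ x) (hxy : x ≤ y) (hy : 1 ≤ y) :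
    Real.posLog x ≤ Real.log y :=
  (Real.posLog_le_posLog hx hxy).trans_eq (Real.posLog_eq_log (hy.trans (le_abs_self y)))

lemma posLog_norm_sub_sub_le_archimedeanEnergy (c₁ c₂ : ℂ) :
    1 / 16 * Real.posLog ‖c₁ - c₂‖ - Real.log 200 ≤ archimedeanEnergy c₁ c₂ := by
  set s := √(max ‖c₁‖ ‖c₂‖)
  have hs0 : 0 ≤ s := Real.sqrt_nonneg _
  have hmax : max ‖c₁‖ ‖c₂‖ = s ^ 2 := (Real.sq_sqrt (le_max_of_le_left (norm_nonneg _))).symm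
  obtain ⟨h₁, h₂⟩ := max_le_iff.1 hmax.le
  have hδ : ‖c₁ - c₂‖ ≤ 2 * s ^ 2 := (norm_sub_le _ _).trans (by linarith)
  have hposLog {y : ℝ} (hy : 1 ≤ y) (h : ‖c₁ - c₂‖ ≤ y) : Real.posLog ‖c₁ - c₂‖ ≤ Real.log y :=
    posLog_le_log (norm_nonneg _) h hy
  have h200 : 0 ≤ Real.log 200 := Real.log_nonneg (by norm_num)
  have hE := archimedeanEnergy_nonneg c₁ c₂
  obtain hs | hs := lt_or_ge s 10
  · linarith [hposLog (y := 200) (by norm_num) (by nlinarith)]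
  have hlog_mul {a : ℝ} (ha : 0 < a) : Real.log (a * s) = Real.log a + Real.log s :=
    Real.log_mul ha.ne' (by positivity)
  obtain hclose | hsep := lt_or_ge (s * ‖c₁ - c₂‖) 3
  · have := hposLog le_rfl (by nlinarith [norm_nonneg (c₁ - c₂)])
    rw [Real.log_one] at this
    linarith
  obtain hnear | hfar := le_total ‖c₁ - c₂‖ (3 * s + 1)
  · have := sixteenth_log_le_archimedeanEnergy hs hmax hnear hsep
    have := hposLog (y := 4 * s) (by linarith) (by linarith)
    rw [hlog_mul (by norm_num)] at this
    have : Real.log 4 ≤ Real.log 200 := Real.log_le_log (by norm_num) (by norm_num)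
    linarith
  · have := half_log_le_archimedeanEnergy (by positivity) h₁ h₂ hfar
    have hlog := hposLog (y := 2 * s ^ 2) (by nlinarith) hδ
    rw [Real.log_mul (by norm_num) (by positivity), Real.log_pow] at hlog
    push_cast at hlog
    have : Real.log 2 ≤ Real.log 200 := Real.log_le_log (by norm_num) (by norm_num)
    have : 0 ≤ Real.log s := Real.log_nonneg (by linarith)
    linarith

lemma log_max_norm_le_archimedeanEnergy (h : 100 ≤ max ‖c₁‖ ‖c₂‖)
    (hsep : 3 / √(max ‖c₁‖ ‖c₂‖) ≤ ‖c₁ - c₂‖) :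
    1 / 32 * Real.log (max ‖c₁‖ ‖c₂‖) ≤ archimedeanEnergy c₁ c₂ := by
  set s := √(max ‖c₁‖ ‖c₂‖)
  have hmax : max ‖c₁‖ ‖c₂‖ = s ^ 2 := (Real.sq_sqrt (by linarith)).symm
  have hs : 10 ≤ s := Real.le_sqrt_of_sq_le (by linarith)
  obtain ⟨h₁, h₂⟩ := max_le_iff.1 hmax.le
  have hsep : 3 ≤ s * ‖c₁ - c₂‖ := (div_le_iff₀' (by positivity)).1 hsep
  have hlog : 0 ≤ Real.log s := Real.log_nonneg (by linarith)
  rw [hmax, Real.log_pow]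
  push_cast
  obtain hnear | hfar := le_total ‖c₁ - c₂‖ (3 * s + 1)
  · linarith [sixteenth_log_le_archimedeanEnergy hs hmax hnear hsep]
  · linarith [half_log_le_archimedeanEnergy (by positivity) h₁ h₂ hfar]

end QuadraticEnergy

theorem mainTheorem7 :
    (∃ C C' : ℝ, 0 < C ∧ 0 < C' ∧ ∀ c₁ c₂ : ℂ,
      Integrable (escapeRate c₁) (equilibriumMeasure c₂) ∧
      1 / 16 * Real.posLog ‖c₁ - c₂‖ - C ≤ archimedeanEnergy c₁ c₂ ∧
      archimedeanEnergy c₁ c₂ ≤ 1 / 2 * Real.posLog (max ‖c₁‖ ‖c₂‖) + C') ∧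
    (∀ (c₁ c₂ : ℂ) (r : ℝ), r = max ‖c₁‖ ‖c₂‖ → 1000 ≤ r → 3 / √r ≤ ‖c₁ - c₂‖ →
      1 / 64 * Real.log r ≤ archimedeanEnergy c₁ c₂) := by
  refine ⟨⟨Real.log 200, Real.log 3, Real.log_pos (by norm_num), Real.log_pos (by norm_num),
    fun c₁ c₂ => ⟨?_, ?_, ?_⟩⟩, ?_⟩
  · exact QuadraticEnergy.integrable_equilibriumMeasure
      (QuadraticEnergy.continuous_escapeRate c₁) c₂
  · exact QuadraticEnergy.posLog_norm_sub_sub_le_archimedeanEnergy c₁ c₂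
  · exact QuadraticEnergy.archimedeanEnergy_le c₁ c₂
  · rintro c₁ c₂ _ rfl hr hsep
    have henergy := QuadraticEnergy.log_max_norm_le_archimedeanEnergy (by linarith) hsep
    have hlog := Real.log_nonneg (show 1 ≤ max ‖c₁‖ ‖c₂‖ by linarith)
    linarith
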